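/- Let $K$ be a field of characteristic $0$. For compositions $\lambda,\mu$ of $n$, the seaweed algebra $\mathfrak p_n\frac{\lambda}{\mu}\subseteq\mathfrak{gl}_n(K)$ is the Lie algebra of all $n\times n$ matrices whose nonzero entries above the diagonal lie in the diagonal blocks of sizes $\lambda_1,\lambda_2,\dots$ and whose nonzero entries below the diagonal lie in the diagonal blocks of sizes $\mu_1,\mu_2,\dots$ (diagonal entries are arbitrary). The index of the meander $\frac{\lambda}{\mu}$ is the index of this Lie algebra, where $\operatorname{ind}(\mathfrak g)=\min_{f\in\mathfrak g^*}\dim\{x\in\mathfrak g: f([x,y])=0\text{ for all }y\in\mathfrak g\}$. For a set $J$ of positive integers let $a^J_{n,k}$ be the number of pairs $(\lambda,\mu)$ of compositions of $n$ with all parts in $J$ such that the meander $\frac{\lambda}{\mu}$ has index $k$ (with $a^J_{0,0}=1$, from the empty pair), and let $A_J(x,y)=\sum_{n,k\ge 0}a^J_{n,k}x^ny^k$, a formal power series. Theorem. We have $$A_{\{1,5\}}(x,y)=\frac{f}{g},$$ where $$f=1-x^3y-x^4y^2-2x^5y-x^6y^2+x^8y^2+x^{10}y^2,$$ $$g=(1-xy-x^5y^5)\,f-2x^5y^2\,(x+y+x^2y-x^4y-x^6y)$$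 (the quotient being taken in the ring of formal power series, in which $g$ is a unit). Moreover, for every integer $c\ge 1$, $$A_{\{c,5c\}}(x,y)=A_{\{1,5\}}(x^c,y^c).$$ -/

import Mathlib

attribute [local instance 100] LieRing.ofAssociativeRing

/-- The stabilizer `𝔤_f = {x ∈ 𝔤 | f ⁅x, y⁆ = 0 for all y ∈ 𝔤}` of a linear form `f` under the
coadjoint action. -/
def coadjointStabilizer (K L : Type*) [Field K] [LieRing L] [LieAlgebra K L]
    (f : Module.Dual K L) : Submodule K L where
  carrier := {x | ∀ y : L, f ⁅x, y⁆ = 0}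
  add_mem' := by
    intro a b ha hb y
    rw [add_lie, map_add, ha y, hb y, add_zero]
  zero_mem' := by
    intro y
    rw [zero_lie, map_zero]
  smul_mem' := by
    intro t a ha y
    rw [smul_lie, map_smul, ha y, smul_zero]

/-- The index of a finite-dimensional Lie algebra: the minimum of `dim 𝔤_f` over `f ∈ 𝔤*`. -/
noncomputable def lieIndex (K L : Type*) [Field K] [LieRing L] [LieAlgebra K L] : ℕ :=
  ⨅ f : Module.Dual K L, Module.finrank K (coadjointStabilizer K L f)

/-- The positions `(i, j)` at which matrices of the seaweed algebra of `lam / mu` may be nonzero: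
above the diagonal, those in the diagonal blocks of `lam`; below the diagonal, those in the
diagonal blocks of `mu`; and the whole diagonal. -/
def seaweedPattern {n : ℕ} (lam mu : Composition n) (i j : Fin n) : Prop :=
  (i < j → lam.index i = lam.index j) ∧ (j < i → mu.index i = mu.index j)

/-- The block number is monotone in the position. -/
theorem composition_index_mono {n : ℕ} (c : Composition n) {i j : Fin n} (h : i ≤ j) :
    c.index i ≤ c.index j := by
  by_contra hlt
  push Not at hlt
  have h1 : c.sizeUpTo (c.index i) ≤ i := c.sizeUpTo_index_le i
  have h2 : (j : ℕ) < c.sizeUpTo (c.index j).succ := c.lt_sizeUpTo_index_succ j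
  have h3 : c.sizeUpTo (c.index j).succ ≤ c.sizeUpTo (c.index i) := by
    apply c.monotone_sizeUpTo
    have : (c.index j : ℕ) < (c.index i : ℕ) := hlt
    simpa using this
  have h4 : (i : ℕ) ≤ j := h
  omega

theorem seaweedPattern_trans {n : ℕ} {lam mu : Composition n} {i j k : Fin n}
    (hij : seaweedPattern lam mu i j) (hjk : seaweedPattern lam mu j k) :
    seaweedPattern lam mu i k := by
  have key : ∀ (c : Composition n) {a b d : Fin n}, a ≤ b → b ≤ d → c.index a = c.index d →
      c.index a = c.index b ∧ c.index b = c.index d := by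
    intro c a b d hab hbd h
    have h1 := composition_index_mono c hab
    have h2 := composition_index_mono c hbd
    exact ⟨le_antisymm h1 (h ▸ h2), le_antisymm h2 (h ▸ h1)⟩
  constructor
  · intro hik
    rcases lt_trichotomy i j with h1 | h1 | h1
    · rcases lt_trichotomy j k with h2 | h2 | h2
      · exact (hij.1 h1).trans (hjk.1 h2)
      · exact h2 ▸ hij.1 h1
      · exact (key lam hik.le h2.le (hij.1 h1)).1
    · exact h1 ▸ hjk.1 (h1 ▸ hik)
    · exact (key lam h1.le hik.le (hjk.1 (h1.trans hik))).2
  · intro hki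
    rcases lt_trichotomy i j with h1 | h1 | h1
    · exact (key mu hki.le h1.le (hjk.2 (hki.trans h1)).symm).1.symm
    · exact h1 ▸ hjk.2 (h1 ▸ hki)
    · rcases lt_trichotomy j k with h2 | h2 | h2
      · exact (key mu h2.le hki.le (hij.2 h1).symm).2.symm
      · exact h2 ▸ hij.2 h1
      · exact (hij.2 h1).trans (hjk.2 h2)

/-- The seaweed algebra of `lam / mu`, a Lie subalgebra of `𝔤𝔩ₙ(K)`. -/
def seaweedAlgebra (K : Type*) [Field K] {n : ℕ} (lam mu : Composition n) :
    LieSubalgebra K (Matrix (Fin n) (Fin n) K) where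
  carrier := {A | ∀ i j, A i j ≠ 0 → seaweedPattern lam mu i j}
  add_mem' := by
    intro A B hA hB i j h
    by_cases hAij : A i j = 0
    · apply hB
      intro hBij
      exact h (by rw [Matrix.add_apply, hAij, hBij, add_zero])
    · exact hA i j hAij
  zero_mem' := by
    intro i j h
    exact absurd rfl h
  smul_mem' := by
    intro t A hA i j h
    apply hA
    intro hAij
    exact h (by rw [Matrix.smul_apply, hAij, smul_zero])
  lie_mem' := by
    intro A B hA hB i j h
    have mul : ∀ A B : Matrix (Fin n) (Fin n) K,
        (∀ i j, A i j ≠ 0 → seaweedPattern lam mu i j) →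
        (∀ i j, B i j ≠ 0 → seaweedPattern lam mu i j) →
        (A * B) i j ≠ 0 → seaweedPattern lam mu i j := by
      intro A B hA hB h
      rw [Matrix.mul_apply] at h
      obtain ⟨k, -, hk⟩ := Finset.exists_ne_zero_of_sum_ne_zero h
      exact seaweedPattern_trans (hA _ _ (left_ne_zero_of_mul hk))
        (hB _ _ (right_ne_zero_of_mul hk))
    rw [Ring.lie_def, Matrix.sub_apply] at h
    by_cases hAB : (A * B) i j = 0
    · by_cases hBA : (B * A) i j = 0
      · exact absurd (by rw [hAB, hBA, sub_zero]) h
      · exact mul B A hB hA hBA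
    · exact mul A B hA hB hAB

/-- The index of the meander `lam / mu`: the index of the associated seaweed algebra. -/
noncomputable def meanderIndex (K : Type*) [Field K] {n : ℕ} (lam mu : Composition n) : ℕ :=
  lieIndex K (seaweedAlgebra K lam mu)

/-- The number of meanders `lam / mu` with `n` nodes and index `k`, where all parts of `lam` and
of `mu` belong to `J`. -/
noncomputable def meanderCount (K : Type*) [Field K] (J : Set ℕ) (n k : ℕ) : ℕ :=
  Set.ncard {p : Composition n × Composition n |
    (∀ a ∈ p.1.blocks, a ∈ J) ∧ (∀ a ∈ p.2.blocks, a ∈ J) ∧ meanderIndex K p.1 p.2 = k}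

/-- The generating function `A_J(x, y) = ∑ aₙₖ xⁿ yᵏ`, with `x` and `y` the variables indexed by
`0` and `1`. -/
noncomputable def meanderGenFun (K : Type*) [Field K] (J : Set ℕ) : MvPowerSeries (Fin 2) ℚ :=
  fun d => (meanderCount K J (d 0) (d 1) : ℚ)

/-! The index of a seaweed algebra obeys Panyushev's reduction. If both compositions begin with a, a
direct summand gl_a splits off and contributes a (`listIndex_cons_cons`, `lieIndex_matrix`). If they
begin with a < b, then (a,λ)/(b,μ) has the same index as λ/(b-2a,a,μ) when 2a ≤ b
(`listIndex_fold_short`), and as (2a-b,λ)/(a,μ) otherwise (`listIndex_fold_long`); the number of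
points drops.

Both folds are cases of one statement, `lieIndex_unfoldRel`. The larger algebra contains an abelian
ideal N, a rectangular block. If a linear form restricts to N as a trace, then the orthogonal of N
is N plus a copy of the smaller algebra, so the stabilizers in the two algebras have equal dimension
(`finrank_stabilizer_eq_of_isotropic`). Over an infinite field an arbitrary form can be perturbed
without enlarging its stabilizer and then conjugated to such a form
(`exists_isNormalForm_finrank_le`).

For parts 1 and 5, reduction from the left leaves only a short prefix w on one side, and only five
prefixes occur. With F_w the series of pairs l/(w,m), the reductions read F_∅ = 1 + (xy + x⁵y⁵)F_∅ +
2x F_31, F_31 = x F_111 + x⁴y F_1, F_1 = xy F_∅ + x F_31, F_11 = xy F_1 + x² F_111, F_111 = (xy +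
x³y) F_11. Eliminating all but F_∅ gives f/g. The reductions commute with multiplying every part by
c, which scales the index by c and gives the last claim. -/

/-! ### Index of a Lie algebra: products, orthogonal reduction, semicontinuity. -/

section LieIndex

variable {K : Type*} [Field K]

theorem mem_coadjointStabilizer {L : Type*} [LieRing L] [LieAlgebra K L]
    {f : Module.Dual K L} {x : L} :
    x ∈ coadjointStabilizer K L f ↔ ∀ y : L, f ⁅x, y⁆ = 0 := Iff.rfl

theorem lieIndex_le {L : Type*} [LieRing L] [LieAlgebra K L] (f : Module.Dual K L) :
    lieIndex K L ≤ Module.finrank K (coadjointStabilizer K L f) :=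
  ciInf_le (OrderBot.bddBelow _) f

theorem exists_finrank_stabilizer_eq_lieIndex (K L : Type*) [Field K] [LieRing L]
    [LieAlgebra K L] :
    ∃ f : Module.Dual K L, Module.finrank K (coadjointStabilizer K L f) = lieIndex K L :=
  Nat.sInf_mem (Set.range_nonempty _)

theorem le_lieIndex {L : Type*} [LieRing L] [LieAlgebra K L] {m : ℕ}
    (h : ∀ f : Module.Dual K L, m ≤ Module.finrank K (coadjointStabilizer K L f)) :
    m ≤ lieIndex K L := le_ciInf h

theorem finrank_stabilizer_comp_equiv {L L' : Type*} [LieRing L] [LieAlgebra K L]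
    [LieRing L'] [LieAlgebra K L'] (e : L ≃ₗ⁅K⁆ L') (f : Module.Dual K L') :
    Module.finrank K (coadjointStabilizer K L (f ∘ₗ (e : L →ₗ[K] L'))) =
      Module.finrank K (coadjointStabilizer K L' f) := by
  have h : (coadjointStabilizer K L (f ∘ₗ (e : L →ₗ[K] L'))).map
      (e.toLinearEquiv : L →ₗ[K] L') = coadjointStabilizer K L' f := by
    ext x
    simp only [Submodule.mem_map, mem_coadjointStabilizer]
    constructor
    · rintro ⟨z, hz, rfl⟩ y
      have := hz (e.symm y)
      simpa [LieEquiv.map_lie] using this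
    · intro hx
      refine ⟨e.symm x, fun y => ?_, by simp⟩
      have := hx (e y)
      simpa [LieEquiv.map_lie] using this
  rw [← h]
  exact (LinearEquiv.finrank_map_eq e.toLinearEquiv _).symm

theorem lieIndex_congr {L L' : Type*} [LieRing L] [LieAlgebra K L]
    [LieRing L'] [LieAlgebra K L'] (e : L ≃ₗ⁅K⁆ L') : lieIndex K L = lieIndex K L' := by
  apply le_antisymm
  · exact le_lieIndex fun f => (lieIndex_le _).trans (finrank_stabilizer_comp_equiv e f).le
  · exact le_lieIndex fun f => (lieIndex_le _).trans (finrank_stabilizer_comp_equiv e.symm f).le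

theorem lieIndex_prod (L L' : Type*) [LieRing L] [LieAlgebra K L] [LieRing L'] [LieAlgebra K L']
    [FiniteDimensional K L] [FiniteDimensional K L'] :
    lieIndex K (L × L') = lieIndex K L + lieIndex K L' := by
  have key : ∀ f : Module.Dual K (L × L'),
      Module.finrank K (coadjointStabilizer K (L × L') f) =
        Module.finrank K (coadjointStabilizer K L (f ∘ₗ LinearMap.inl K L L')) +
        Module.finrank K (coadjointStabilizer K L' (f ∘ₗ LinearMap.inr K L L')) := by
    intro f
    have h : coadjointStabilizer K (L × L') f =
        (coadjointStabilizer K L (f ∘ₗ LinearMap.inl K L L')).prod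
          (coadjointStabilizer K L' (f ∘ₗ LinearMap.inr K L L')) := by
      ext ⟨a, b⟩
      simp only [Submodule.mem_prod, mem_coadjointStabilizer]
      constructor
      · intro h
        refine ⟨fun y => ?_, fun y => ?_⟩
        · simpa using h (y, 0)
        · simpa using h (0, y)
      · rintro ⟨h1, h2⟩ ⟨c, d⟩
        have e : (⁅(a, b), (c, d)⁆ : L × L') = (⁅a, c⁆, 0) + (0, ⁅b, d⁆) := by simp
        rw [e, map_add]
        have := h1 c
        have := h2 d
        simp_all
    rw [h, ← Module.finrank_prod]
    refine LinearEquiv.finrank_eq (LinearEquiv.ofBijective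
      (((LinearMap.fst K L L').restrict (p := Submodule.prod _ _) (fun p hp => hp.1)).prod
        ((LinearMap.snd K L L').restrict (p := Submodule.prod _ _) (fun p hp => hp.2)))
      ⟨?_, ?_⟩)
    · rintro ⟨⟨a, b⟩, ha⟩ ⟨⟨c, d⟩, hc⟩ hac
      have h1 : a = c := congrArg (fun p => (p.1 : L)) hac
      have h2 : b = d := congrArg (fun p => (p.2 : L')) hac
      subst h1 h2
      rfl
    · rintro ⟨⟨a, ha⟩, ⟨b, hb⟩⟩
      exact ⟨⟨(a, b), ha, hb⟩, rfl⟩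
  apply le_antisymm
  · obtain ⟨f, hf⟩ := exists_finrank_stabilizer_eq_lieIndex K L
    obtain ⟨g, hg⟩ := exists_finrank_stabilizer_eq_lieIndex K L'
    have := key (f.coprod g)
    rw [LinearMap.coprod_inl, LinearMap.coprod_inr, hf, hg] at this
    exact this ▸ lieIndex_le _
  · exact le_lieIndex fun f => (key f).symm ▸ add_le_add (lieIndex_le _) (lieIndex_le _)

/-- Reduction along an isotropic subspace `N` whose orthogonal is `N ⊕ ψ(S)`. -/
theorem finrank_stabilizer_eq_of_isotropic {L S : Type*} [LieRing L] [LieAlgebra K L]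
    [LieRing S] [LieAlgebra K S] [FiniteDimensional K L]
    (f : Module.Dual K L) (N : Submodule K L) (ψ : S →ₗ⁅K⁆ L)
    (hSN : ∀ s : S, ∀ n ∈ N, f ⁅ψ s, n⁆ = 0)
    (hH : ∀ x : L, (∀ n ∈ N, f ⁅x, n⁆ = 0) → ∃ n ∈ N, ∃ s : S, x = n + ψ s)
    (hdisj : ∀ s : S, ψ s ∈ N → s = 0)
    (hrad : ∀ n ∈ N, (∀ x : L, f ⁅x, n⁆ = 0) → n = 0) :
    Module.finrank K (coadjointStabilizer K L f) =
      Module.finrank K (coadjointStabilizer K S (f ∘ₗ (ψ : S →ₗ[K] L))) := by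
  have skew : ∀ x y : L, f ⁅x, y⁆ = - f ⁅y, x⁆ := fun x y => by rw [← lie_skew, map_neg]
  -- W consists of the decompositions n + ψ s of stabilizer elements. The map (n, s) ↦ n + ψ s
  -- identifies W with the stabilizer of f, and (n, s) ↦ s identifies it with the stabilizer of the
  -- pulled back form.
  let W : Submodule K (L × S) :=
    { carrier := {p | p.1 ∈ N ∧ p.1 + ψ p.2 ∈ coadjointStabilizer K L f}
      add_mem' := by
        rintro a b ⟨ha, ha'⟩ ⟨hb, hb'⟩
        refine ⟨N.add_mem ha hb, ?_⟩
        have : (a + b).1 + ψ (a + b).2 = (a.1 + ψ a.2) + (b.1 + ψ b.2) := by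
          simp only [Prod.fst_add, Prod.snd_add, map_add]; abel
        rw [this]
        exact Submodule.add_mem _ ha' hb'
      zero_mem' := ⟨N.zero_mem, by simp⟩
      smul_mem' := by
        rintro t a ⟨ha, ha'⟩
        refine ⟨N.smul_mem t ha, ?_⟩
        have : (t • a).1 + ψ (t • a).2 = t • (a.1 + ψ a.2) := by simp
        rw [this]
        exact Submodule.smul_mem _ t ha' }
  let B : L →ₗ[K] Module.Dual K L := (LieModule.toEnd K L L : L →ₗ[K] Module.End K L).compr₂ f
  have hB : ∀ x y, B x y = f ⁅x, y⁆ := fun x y => rfl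
  let H : Submodule K L := LinearMap.ker ((Submodule.dualRestrict N) ∘ₗ B)
  have memH : ∀ x, x ∈ H ↔ ∀ n ∈ N, f ⁅x, n⁆ = 0 := by
    intro x
    simp only [H, LinearMap.mem_ker, LinearMap.ext_iff]
    exact ⟨fun h n hn => h ⟨n, hn⟩, fun h n => h n n.2⟩
  -- H, the orthogonal of N, has codimension at most dim N. As N meets the radical of the form
  -- trivially, it embeds in the annihilator of H, and comparing dimensions makes this embedding
  -- onto.
  have hdim : Module.finrank K H.dualAnnihilator ≤ Module.finrank K N := by
    have h1 := LinearMap.finrank_range_add_finrank_ker ((Submodule.dualRestrict N) ∘ₗ B)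
    have h2 := Subspace.finrank_add_finrank_dualAnnihilator_eq H
    have h3 := Submodule.finrank_le (LinearMap.range ((Submodule.dualRestrict N) ∘ₗ B))
    rw [Subspace.dual_finrank_eq] at h3
    change _ + Module.finrank K H = _ at h1
    omega
  have hNH : ∀ n ∈ N, B n ∈ H.dualAnnihilator := by
    intro n hn
    rw [Submodule.mem_dualAnnihilator]
    intro x hx
    rw [hB, skew, (memH x).1 hx n hn, neg_zero]
  let β : N →ₗ[K] H.dualAnnihilator := (B.domRestrict N).codRestrict _ (fun n => hNH n n.2)
  have hβ : Function.Injective β := by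
    rw [injective_iff_map_eq_zero]
    intro n hn
    apply Subtype.ext
    apply hrad n n.2
    intro x
    have : B n = 0 := congrArg Subtype.val hn
    rw [skew, ← hB, this]; simp
  have hβs : Function.Surjective β := by
    have h1 := LinearMap.finrank_range_of_inj hβ
    rw [← LinearMap.range_eq_top]
    refine Submodule.eq_top_of_finrank_eq (K := K) (V := H.dualAnnihilator) ?_
    apply le_antisymm (Submodule.finrank_le _)
    omega
  let p1 : W →ₗ[K] coadjointStabilizer K L f :=
    ((LinearMap.fst K L S + (ψ : S →ₗ[K] L) ∘ₗ LinearMap.snd K L S).domRestrict W).codRestrict _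
      (fun w => w.2.2)
  let p2 : W →ₗ[K] coadjointStabilizer K S (f ∘ₗ (ψ : S →ₗ[K] L)) :=
    ((LinearMap.snd K L S).domRestrict W).codRestrict _ (by
      rintro ⟨⟨n, s⟩, hn, hs⟩ s'
      have h1 := hs (ψ s')
      have h2 := hSN s' n hn
      rw [skew] at h2
      simp only [add_lie, map_add, neg_eq_zero] at h1 h2
      rw [h2, zero_add] at h1
      simpa using h1)
  have b1 : Function.Bijective p1 := by
    constructor
    · rw [injective_iff_map_eq_zero]
      rintro ⟨⟨n, s⟩, hn, hs⟩ h
      have h' : n + ψ s = 0 := congrArg Subtype.val h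
      have hs0 : s = 0 := hdisj s (by rw [eq_neg_of_add_eq_zero_right h']; exact N.neg_mem hn)
      subst hs0
      simp only [map_zero, add_zero] at h'
      simp [h']
    · rintro ⟨x, hx⟩
      obtain ⟨n, hn, s, rfl⟩ := hH x (fun n _ => hx n)
      exact ⟨⟨(n, s), hn, hx⟩, rfl⟩
  have b2 : Function.Bijective p2 := by
    constructor
    · rw [injective_iff_map_eq_zero]
      rintro ⟨⟨n, s⟩, hn, hs⟩ h
      have h' : s = 0 := congrArg Subtype.val h
      subst h'
      have hn0 : n = 0 := hrad n hn (fun x => by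
        have := hs x
        rw [skew]
        simpa using this)
      simp [hn0]
    · rintro ⟨s, hs⟩
      have hann : B (ψ s) ∈ H.dualAnnihilator := by
        rw [Submodule.mem_dualAnnihilator]
        intro x hx
        obtain ⟨n, hn, s', rfl⟩ := hH x ((memH x).1 hx)
        have h1 := hSN s n hn
        have h2 := hs s'
        rw [hB, lie_add, map_add, h1, zero_add]
        simpa using h2
      obtain ⟨n, hn⟩ := hβs ⟨_, hann⟩
      have hn' : B n = B (ψ s) := congrArg Subtype.val hn
      -- The functional f⁅ψ s, ·⁆ kills H, hence equals f⁅n, ·⁆ for some n in N; subtracting n moves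
      -- ψ s into the stabilizer of f.
      refine ⟨⟨(-n, s), N.neg_mem n.2, fun y => ?_⟩, rfl⟩
      have := LinearMap.congr_fun hn' y
      rw [hB, hB] at this
      change f ⁅-(n : L) + ψ s, y⁆ = 0
      rw [add_lie, neg_lie, map_add, map_neg, this, neg_add_cancel]
  rw [← (LinearEquiv.ofBijective p1 b1).finrank_eq, (LinearEquiv.ofBijective p2 b2).finrank_eq]

/-- Singularity of 1 + tM forces -t⁻¹ to be an eigenvalue of M. -/
theorem finite_setOf_not_isUnit_one_add_smul {V : Type*} [AddCommGroup V] [Module K V]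
    [FiniteDimensional K V] (M : Module.End K V) :
    {t : K | ¬ IsUnit (1 + t • M)}.Finite := by
  apply ((Module.End.finite_spectrum M).image (fun z => -z⁻¹)).subset
  intro t ht
  have ht0 : t ≠ 0 := by
    rintro rfl
    apply ht
    simp
  refine ⟨-t⁻¹, ?_, by simp⟩
  rw [spectrum.mem_iff]
  intro hu
  apply ht
  have : (1 + t • M) = (-t) • (algebraMap K (Module.End K V) (-t⁻¹) - M) := by
    rw [smul_sub, Algebra.algebraMap_eq_smul_one, smul_smul]
    simp [ht0]
  rw [this]
  exact hu.smul (Units.mk0 (-t) (neg_ne_zero.2 ht0))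

/-- Semicontinuity of rank along a line. Take g with Φ g Φ = Φ. Then 1 + t gΨ maps ker(Φ + tΨ) into
ker Φ, and it is invertible for all but finitely many t. -/
theorem finite_setOf_finrank_ker_lt {V W : Type*} [AddCommGroup V] [Module K V]
    [FiniteDimensional K V] [AddCommGroup W] [Module K W] (Φ Ψ : V →ₗ[K] W) :
    {t : K | Module.finrank K (LinearMap.ker Φ) <
      Module.finrank K (LinearMap.ker (Φ + t • Ψ))}.Finite := by
  obtain ⟨h, hh⟩ := Φ.rangeRestrict.exists_rightInverse_of_surjective Φ.range_rangeRestrict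
  obtain ⟨g, hg⟩ := LinearMap.exists_extend h
  have hΦ : ∀ v, Φ (g (Φ v)) = Φ v := by
    intro v
    have h1 : g (Φ v) = h (Φ.rangeRestrict v) := LinearMap.congr_fun hg (Φ.rangeRestrict v)
    have h2 := LinearMap.congr_fun hh (Φ.rangeRestrict v)
    rw [h1]
    exact congrArg Subtype.val h2
  apply (finite_setOf_not_isUnit_one_add_smul (g ∘ₗ Ψ)).subset
  intro t ht hu
  apply absurd ht
  simp only [Set.mem_ofPred_eq, not_lt]
  have hinj : Function.Injective (1 + t • (g ∘ₗ Ψ) : Module.End K V) :=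
    ((Module.End.isUnit_iff _).1 hu).1
  let T : LinearMap.ker (Φ + t • Ψ) →ₗ[K] LinearMap.ker Φ :=
    ((1 + t • (g ∘ₗ Ψ) : Module.End K V).domRestrict _).codRestrict _ (by
      rintro ⟨v, hv⟩
      have hv' : Φ v + t • Ψ v = 0 := hv
      have : t • Ψ v = - Φ v := eq_neg_of_add_eq_zero_right hv'
      simp only [LinearMap.domRestrict_apply, LinearMap.mem_ker, LinearMap.add_apply,
        LinearMap.smul_apply, LinearMap.comp_apply, Module.End.one_apply]
      rw [← map_smul, this, map_neg, map_add, map_neg, hΦ, add_neg_cancel])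
  exact LinearMap.finrank_le_finrank_of_injective (f := T) (by
    intro a b hab
    exact Subtype.ext (hinj (congrArg Subtype.val hab)))

theorem finite_setOf_finrank_stabilizer_lt {L : Type*} [LieRing L] [LieAlgebra K L]
    [FiniteDimensional K L] (f₀ f₁ : Module.Dual K L) :
    {t : K | Module.finrank K (coadjointStabilizer K L f₀) <
      Module.finrank K (coadjointStabilizer K L (f₀ + t • f₁))}.Finite := by
  let B : Module.Dual K L → L →ₗ[K] Module.Dual K L :=
    fun f => (LieModule.toEnd K L L : L →ₗ[K] Module.End K L).compr₂ f
  have hB : ∀ f, coadjointStabilizer K L f = LinearMap.ker (B f) := by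
    intro f
    ext x
    rw [mem_coadjointStabilizer, LinearMap.mem_ker, LinearMap.ext_iff]
    rfl
  have hadd : ∀ t : K, B (f₀ + t • f₁) = B f₀ + t • B f₁ := by
    intro t
    ext x y
    simp [B]
  refine (finite_setOf_finrank_ker_lt (B f₀) (B f₁)).subset fun t ht => ?_
  rw [Set.mem_ofPred_eq, hB, hB, hadd] at ht
  exact ht

end LieIndex

/-! ### Matrix Lie algebras supported on a transitive relation. -/

section PatternAlgebra

/-- The Lie algebra of matrices supported on a transitive relation. -/
def patternAlgebra (K : Type*) [Field K] {ι : Type*} [Fintype ι] [DecidableEq ι]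
    (R : ι → ι → Prop) (hR : ∀ i j k, R i j → R j k → R i k) :
    LieSubalgebra K (Matrix ι ι K) where
  carrier := {A | ∀ i j, A i j ≠ 0 → R i j}
  add_mem' := by
    intro A B hA hB i j h
    by_cases hAij : A i j = 0
    · apply hB
      intro hBij
      exact h (by rw [Matrix.add_apply, hAij, hBij, add_zero])
    · exact hA i j hAij
  zero_mem' := by
    intro i j h
    exact absurd rfl h
  smul_mem' := by
    intro t A hA i j h
    apply hA
    intro hAij
    exact h (by rw [Matrix.smul_apply, hAij, smul_zero])
  lie_mem' := by
    intro A B hA hB i j h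
    have mul : ∀ A B : Matrix ι ι K, (∀ i j, A i j ≠ 0 → R i j) → (∀ i j, B i j ≠ 0 → R i j) →
        (A * B) i j ≠ 0 → R i j := by
      intro A B hA hB h
      rw [Matrix.mul_apply] at h
      obtain ⟨k, -, hk⟩ := Finset.exists_ne_zero_of_sum_ne_zero h
      exact hR _ _ _ (hA _ _ (left_ne_zero_of_mul hk)) (hB _ _ (right_ne_zero_of_mul hk))
    rw [Ring.lie_def, Matrix.sub_apply] at h
    by_cases hAB : (A * B) i j = 0
    · by_cases hBA : (B * A) i j = 0
      · exact absurd (by rw [hAB, hBA, sub_zero]) h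
      · exact mul B A hB hA hBA
    · exact mul A B hA hB hAB

variable {K : Type*} [Field K] {ι ι' : Type*} [Fintype ι] [DecidableEq ι] [Fintype ι']
  [DecidableEq ι'] {R : ι → ι → Prop} {hR : ∀ i j k, R i j → R j k → R i k}
  {R' : ι' → ι' → Prop} {hR' : ∀ i j k, R' i j → R' j k → R' i k}

theorem patternAlgebra_apply_eq_zero (A : patternAlgebra K R hR) {i j : ι} (h : ¬ R i j) :
    (A : Matrix ι ι K) i j = 0 := by
  by_contra hne
  exact h (A.2 i j hne)

theorem single_mem_patternAlgebra {i j : ι} (h : R i j) (c : K) :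
    Matrix.single i j c ∈ patternAlgebra K R hR := by
  intro a b hab
  rw [Matrix.single_apply] at hab
  split_ifs at hab with h'
  · obtain ⟨rfl, rfl⟩ := h'
    exact h
  · exact absurd rfl hab

theorem mul_mem_patternAlgebra {A B : Matrix ι ι K} (hA : A ∈ patternAlgebra K R hR)
    (hB : B ∈ patternAlgebra K R hR) : A * B ∈ patternAlgebra K R hR := by
  intro i j h
  rw [Matrix.mul_apply] at h
  obtain ⟨k, -, hk⟩ := Finset.exists_ne_zero_of_sum_ne_zero h
  exact hR _ _ _ (hA _ _ (left_ne_zero_of_mul hk)) (hB _ _ (right_ne_zero_of_mul hk))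

/-- Rows and columns outside the range of e vanish identically, so deleting them is an isomorphism
of Lie algebras. Reflexivity of the relations is never required, which allows superfluous index
points. -/
theorem lieIndex_patternAlgebra_embedding (e : ι → ι') (he : Function.Injective e)
    (h : ∀ i j, R' (e i) (e j) ↔ R i j)
    (hrange : ∀ x y, R' x y → x ∈ Set.range e ∧ y ∈ Set.range e) :
    lieIndex K (patternAlgebra K R' hR') = lieIndex K (patternAlgebra K R hR) := by
  have hmul : ∀ A B : patternAlgebra K R' hR',
      ((A : Matrix ι' ι' K) * (B : Matrix ι' ι' K)).submatrix e e =
        (A : Matrix ι' ι' K).submatrix e e * (B : Matrix ι' ι' K).submatrix e e := by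
    intro A B
    ext i j
    simp only [Matrix.submatrix_apply, Matrix.mul_apply]
    symm
    apply Fintype.sum_of_injective e he
    · intro x hx
      rw [patternAlgebra_apply_eq_zero A (fun h => hx (hrange _ _ h).2), zero_mul]
    · intro i
      rfl
  let φ : patternAlgebra K R' hR' →ₗ⁅K⁆ patternAlgebra K R hR :=
    { toFun := fun A => ⟨(A : Matrix ι' ι' K).submatrix e e, fun i j hij =>
        (h i j).1 (A.2 _ _ hij)⟩
      map_add' := fun A B => rfl
      map_smul' := fun t A => rfl
      map_lie' := by
        intro A B
        apply Subtype.ext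
        simp only [LieSubalgebra.coe_bracket, Ring.lie_def, Matrix.submatrix_sub, Pi.sub_apply,
          hmul] }
  refine lieIndex_congr (LieEquiv.ofBijective φ ⟨?_, ?_⟩)
  · intro A B hAB
    ext x y
    have hAB' : (A : Matrix ι' ι' K).submatrix e e = (B : Matrix ι' ι' K).submatrix e e :=
      congrArg Subtype.val hAB
    by_cases hxy : x ∈ Set.range e ∧ y ∈ Set.range e
    · obtain ⟨⟨i, rfl⟩, ⟨j, rfl⟩⟩ := hxy
      exact congrFun (congrFun hAB' i) j
    · rw [patternAlgebra_apply_eq_zero A fun h => hxy (hrange _ _ h),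
        patternAlgebra_apply_eq_zero B fun h => hxy (hrange _ _ h)]
  · intro A
    classical
    let B : Matrix ι' ι' K := Matrix.of fun x y =>
      if hxy : x ∈ Set.range e ∧ y ∈ Set.range e then
        (A : Matrix ι ι K) hxy.1.choose hxy.2.choose else 0
    have hB : ∀ i j, B (e i) (e j) = (A : Matrix ι ι K) i j := by
      intro i j
      have hxy : e i ∈ Set.range e ∧ e j ∈ Set.range e := ⟨⟨i, rfl⟩, ⟨j, rfl⟩⟩
      simp only [B, Matrix.of_apply, dif_pos hxy]
      rw [he hxy.1.choose_spec, he hxy.2.choose_spec]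
    refine ⟨⟨B, ?_⟩, ?_⟩
    · intro x y hne
      by_cases hxy : x ∈ Set.range e ∧ y ∈ Set.range e
      · obtain ⟨⟨i, rfl⟩, ⟨j, rfl⟩⟩ := hxy
        rw [hB] at hne
        exact (h i j).2 (A.2 i j hne)
      · exact absurd (by simp only [B, Matrix.of_apply, dif_neg hxy]) hne
    · apply Subtype.ext
      ext i j
      exact hB i j

/-- The isomorphism is X ↦ -Xᵀ. -/
theorem lieIndex_patternAlgebra_swap
    {R₂ : ι → ι → Prop} {hR₂ : ∀ i j k, R₂ i j → R₂ j k → R₂ i k} (h : ∀ i j, R₂ i j ↔ R j i) :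
    lieIndex K (patternAlgebra K R₂ hR₂) = lieIndex K (patternAlgebra K R hR) := by
  let φ : patternAlgebra K R₂ hR₂ →ₗ⁅K⁆ patternAlgebra K R hR :=
    { toFun := fun A => ⟨-(A : Matrix ι ι K).transpose, fun i j hij =>
        (h j i).1 (A.2 _ _ (by simpa using hij))⟩
      map_add' := fun A B => by
        apply Subtype.ext
        change -((A : Matrix ι ι K) + (B : Matrix ι ι K)).transpose =
          -(A : Matrix ι ι K).transpose + -(B : Matrix ι ι K).transpose
        rw [Matrix.transpose_add]; abel
      map_smul' := fun t A => by
        apply Subtype.ext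
        change -(t • (A : Matrix ι ι K)).transpose = t • -(A : Matrix ι ι K).transpose
        rw [Matrix.transpose_smul, smul_neg]
      map_lie' := by
        intro A B
        apply Subtype.ext
        simp only [LieSubalgebra.coe_bracket, Ring.lie_def, Matrix.transpose_sub,
          Matrix.transpose_mul]
        noncomm_ring }
  refine lieIndex_congr (LieEquiv.ofBijective φ ⟨?_, ?_⟩)
  · intro A B hAB
    have hAB' : -(A : Matrix ι ι K).transpose = -(B : Matrix ι ι K).transpose :=
      congrArg Subtype.val hAB
    exact Subtype.ext (Matrix.transpose_injective (neg_injective hAB'))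
  · intro A
    refine ⟨⟨-(A : Matrix ι ι K).transpose, fun i j hij =>
      (h i j).2 (A.2 _ _ (by simpa using hij))⟩, ?_⟩
    apply Subtype.ext
    change -(-(A : Matrix ι ι K).transpose).transpose = A
    simp

/-- Conjugation by a unit `w` such that `w - 1` and `w⁻¹ - 1` are supported on the relation. -/
theorem exists_conj_patternAlgebra {w w' : Matrix ι ι K} (h : w * w' = 1)
    (hw : w - 1 ∈ patternAlgebra K R hR) (hw' : w' - 1 ∈ patternAlgebra K R hR) :
    ∃ φ : patternAlgebra K R hR ≃ₗ⁅K⁆ patternAlgebra K R hR,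
      ∀ A, (φ A : Matrix ι ι K) = w * A * w' := by
  have h' : w' * w = 1 := mul_eq_one_comm.1 h
  have mem : ∀ {u u' : Matrix ι ι K}, u - 1 ∈ patternAlgebra K R hR →
      u' - 1 ∈ patternAlgebra K R hR → ∀ A : patternAlgebra K R hR,
      u * (A : Matrix ι ι K) * u' ∈ patternAlgebra K R hR := by
    intro u u' hu hu' A
    have e : u * (A : Matrix ι ι K) * u' = A + (u - 1) * A + A * (u' - 1) +
      (u - 1) * A * (u' - 1) := by noncomm_ring
    rw [e]
    refine add_mem (add_mem (add_mem A.2 ?_) ?_) ?_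
    · exact mul_mem_patternAlgebra hu A.2
    · exact mul_mem_patternAlgebra A.2 hu'
    · exact mul_mem_patternAlgebra (mul_mem_patternAlgebra hu A.2) hu'
  let φ : patternAlgebra K R hR →ₗ⁅K⁆ patternAlgebra K R hR :=
    { toFun := fun A => ⟨w * A * w', mem hw hw' A⟩
      map_add' := fun A B => by
        apply Subtype.ext
        change w * ((A : Matrix ι ι K) + B) * w' = w * A * w' + w * B * w'
        noncomm_ring
      map_smul' := fun t A => by
        apply Subtype.ext
        change w * (t • (A : Matrix ι ι K)) * w' = t • (w * A * w')
        simp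
      map_lie' := by
        intro A B
        apply Subtype.ext
        simp only [LieSubalgebra.coe_bracket, Ring.lie_def]
        have e : ∀ A B : Matrix ι ι K, w * A * w' * (w * B * w') = w * (A * B) * w' := by
          intro A B
          calc w * A * w' * (w * B * w') = w * A * (w' * w) * B * w' := by noncomm_ring
            _ = _ := by rw [h']; noncomm_ring
        rw [e, e]
        noncomm_ring }
  have c1 : ∀ A : Matrix ι ι K, w' * (w * A * w') * w = A := fun A => by
    calc w' * (w * A * w') * w = (w' * w) * A * (w' * w) := by noncomm_ring
      _ = A := by rw [h', one_mul, mul_one]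
  have c2 : ∀ A : Matrix ι ι K, w * (w' * A * w) * w' = A := fun A => by
    calc w * (w' * A * w) * w' = (w * w') * A * (w * w') := by noncomm_ring
      _ = A := by rw [h, one_mul, mul_one]
  refine ⟨LieEquiv.ofBijective φ ⟨?_, ?_⟩, fun A => rfl⟩
  · intro A B hAB
    have hAB' : w * (A : Matrix ι ι K) * w' = w * B * w' := congrArg Subtype.val hAB
    apply Subtype.ext
    rw [← c1 A, hAB', c1]
  · intro A
    exact ⟨⟨w' * A * w, mem hw' hw A⟩, Subtype.ext (c2 A)⟩

end PatternAlgebra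

/-! ### Folding: the abelian ideal and its orthogonal. -/

section Fold

variable {κ : Type*}

/-- The relation on two copies of `κ` obtained from `R` by unfolding along `I` and `M`: the left
copy carries the full block `I`, the right copy carries the positions outside `I ∖ M`, and the
left block acts on `M` from the right copy. -/
def unfoldRel (R : κ → κ → Prop) (I M : κ → Prop) : κ ⊕ κ → κ ⊕ κ → Prop
  | .inl i, .inl j => I i ∧ I j
  | .inl _, .inr _ => False
  | .inr k, .inl i => M k ∧ I i
  | .inr k, .inr l => (M k ∨ ¬ I k) ∧ (M l ∨ ¬ I l) ∧ (R k l ∨ (I k ∧ M l ∧ ¬ I l))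

/-- Compatibility of a relation with the pair of sets along which it is unfolded. -/
structure Unfoldable (R : κ → κ → Prop) (I M : κ → Prop) : Prop where
  subset_or : (∀ i, I i → M i) ∨ ∀ k, M k → I k
  mem_of_rel : ∀ k l, R k l → M l ∨ I l → M k ∨ I k
  right_mem : ∀ i l, R i l → I i → M l → I l
  right_mem_diff : ∀ i k, R i k → I i → ¬ M i → I k ∧ ¬ M k
  rel_diff : ∀ k i, I k → I i → ¬ M i → R k i

variable [Fintype κ] [DecidableEq κ] {K : Type*} [Field K]

open Classical in
/-- The compression of a matrix to the positions satisfying a predicate. -/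
noncomputable def compress (p : κ → Prop) : Matrix κ κ K →ₗ[K] Matrix κ κ K where
  toFun A := Matrix.of fun i j => if p i ∧ p j then A i j else 0
  map_add' A B := by ext i j; simp only [Matrix.of_apply, Matrix.add_apply]; split_ifs <;> simp
  map_smul' t A := by ext i j; simp

omit [Fintype κ] [DecidableEq κ] in
theorem compress_of {p : κ → Prop} {A : Matrix κ κ K} {i j : κ} (hi : p i) (hj : p j) :
    compress p A i j = A i j := by
  simp [compress, hi, hj]

omit [Fintype κ] [DecidableEq κ] in
theorem compress_of_not {p : κ → Prop} {A : Matrix κ κ K} {i j : κ} (h : ¬ (p i ∧ p j)) :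
    compress p A i j = 0 := by
  simp only [compress, LinearMap.coe_mk, AddHom.coe_mk, Matrix.of_apply, if_neg h]

omit [DecidableEq κ] in
theorem compress_mul {p : κ → Prop} {A B : Matrix κ κ K}
    (h : ∀ i l j, p i → p j → ¬ p l → A i l * B l j = 0) :
    compress p (A * B) = compress p A * compress p B := by
  ext i j
  rw [Matrix.mul_apply]
  by_cases hij : p i ∧ p j
  · rw [compress_of hij.1 hij.2, Matrix.mul_apply]
    refine Finset.sum_congr rfl fun l _ => ?_
    by_cases hl : p l
    · rw [compress_of hij.1 hl, compress_of hl hij.2]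
    · rw [h i l j hij.1 hij.2 hl, compress_of_not (fun h => hl h.2), zero_mul]
  · rw [compress_of_not hij]
    symm
    refine Finset.sum_eq_zero fun l _ => ?_
    by_cases hi : p i
    · rw [compress_of_not (A := B) (fun h => hij ⟨hi, h.2⟩), mul_zero]
    · rw [compress_of_not (A := A) (fun h => hi h.1), zero_mul]

variable {R : κ → κ → Prop} {hR : ∀ i j k, R i j → R j k → R i k} {I M : κ → Prop}
  {hU : ∀ x y z, unfoldRel R I M x y → unfoldRel R I M y z → unfoldRel R I M x z}

/-- The diagonal embedding of the folded algebra. -/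
noncomputable def unfoldHom (K : Type*) [Field K] (h : Unfoldable R I M)
    (hR : ∀ i j k, R i j → R j k → R i k)
    (hU : ∀ x y z, unfoldRel R I M x y → unfoldRel R I M y z → unfoldRel R I M x z) :
    patternAlgebra K R hR →ₗ⁅K⁆ patternAlgebra K (unfoldRel R I M) hU where
  toFun A := ⟨Matrix.fromBlocks (compress I A) 0 0 (compress (fun k => M k ∨ ¬ I k) A), by
    rintro (i | k) (j | l) hne
    · rw [Matrix.fromBlocks_apply₁₁] at hne
      by_contra hij
      exact hne (compress_of_not hij)
    · simp at hne
    · simp at hne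
    · rw [Matrix.fromBlocks_apply₂₂] at hne
      by_cases hkl : (M k ∨ ¬ I k) ∧ (M l ∨ ¬ I l)
      · rw [compress_of (p := fun k => M k ∨ ¬ I k) hkl.1 hkl.2] at hne
        exact ⟨hkl.1, hkl.2, Or.inl (A.2 _ _ hne)⟩
      · exact absurd (compress_of_not hkl) hne⟩
  map_add' A B := by
    apply Subtype.ext
    change Matrix.fromBlocks (compress I ((A : Matrix κ κ K) + (B : Matrix κ κ K))) 0 0
      (compress (fun k => M k ∨ ¬ I k) ((A : Matrix κ κ K) + (B : Matrix κ κ K))) =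
      Matrix.fromBlocks (compress I (A : Matrix κ κ K)) 0 0 (compress (fun k => M k ∨ ¬ I k) A) +
      Matrix.fromBlocks (compress I (B : Matrix κ κ K)) 0 0 (compress (fun k => M k ∨ ¬ I k) B)
    rw [Matrix.fromBlocks_add, add_zero, map_add, map_add]
  map_smul' t A := by
    apply Subtype.ext
    change Matrix.fromBlocks (compress I (t • (A : Matrix κ κ K))) 0 0
      (compress (fun k => M k ∨ ¬ I k) (t • (A : Matrix κ κ K))) =
      t • Matrix.fromBlocks (compress I (A : Matrix κ κ K)) 0 0
        (compress (fun k => M k ∨ ¬ I k) (A : Matrix κ κ K))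
    rw [Matrix.fromBlocks_smul, smul_zero, map_smul, map_smul]
  map_lie' := by
    intro A B
    have h1 : ∀ A B : patternAlgebra K R hR, compress I ((A : Matrix κ κ K) * (B : Matrix κ κ K)) =
        compress I (A : Matrix κ κ K) * compress I (B : Matrix κ κ K) := by
      intro A B
      apply compress_mul
      intro i l j hi hj hl
      by_contra hne
      have hA := A.2 _ _ (left_ne_zero_of_mul hne)
      have hB := B.2 _ _ (right_ne_zero_of_mul hne)
      have hMl := (h.mem_of_rel _ _ hB (Or.inr hj)).resolve_right hl
      exact hl (h.right_mem _ _ hA hi hMl)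
    have h2 : ∀ A B : patternAlgebra K R hR,
        compress (fun k => M k ∨ ¬ I k) ((A : Matrix κ κ K) * (B : Matrix κ κ K)) =
        compress (fun k => M k ∨ ¬ I k) (A : Matrix κ κ K) *
          compress (fun k => M k ∨ ¬ I k) (B : Matrix κ κ K) := by
      intro A B
      apply compress_mul
      intro i l j hi hj hl
      by_contra hne
      have hB := B.2 _ _ (right_ne_zero_of_mul hne)
      push Not at hl
      have := h.right_mem_diff _ _ hB hl.2 hl.1
      tauto
    apply Subtype.ext
    simp only [LieSubalgebra.coe_bracket, Ring.lie_def, map_sub, h1, h2,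
      Matrix.fromBlocks_multiply]
    rw [sub_eq_add_neg, sub_eq_add_neg, sub_eq_add_neg, Matrix.fromBlocks_neg,
      Matrix.fromBlocks_add]
    simp

/-- The abelian ideal of matrices supported on the lower left block. -/
def lowerBlock (K : Type*) [Field K]
    (hU : ∀ x y z, unfoldRel R I M x y → unfoldRel R I M y z → unfoldRel R I M x z) :
    Submodule K (patternAlgebra K (unfoldRel R I M) hU) where
  carrier := {A | (∀ i j, (A : Matrix (κ ⊕ κ) (κ ⊕ κ) K) (.inl i) (.inl j) = 0) ∧
    ∀ i j, (A : Matrix (κ ⊕ κ) (κ ⊕ κ) K) (.inr i) (.inr j) = 0}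
  add_mem' := by
    rintro A B ⟨hA, hA'⟩ ⟨hB, hB'⟩
    exact ⟨fun i j => by simp [hA i j, hB i j], fun i j => by simp [hA' i j, hB' i j]⟩
  zero_mem' := ⟨fun _ _ => rfl, fun _ _ => rfl⟩
  smul_mem' := by
    rintro t A ⟨hA, hA'⟩
    exact ⟨fun i j => by simp [hA i j], fun i j => by simp [hA' i j]⟩

theorem patternAlgebra_inl_inr (A : patternAlgebra K (unfoldRel R I M) hU) (i k : κ) :
    (A : Matrix (κ ⊕ κ) (κ ⊕ κ) K) (.inl i) (.inr k) = 0 :=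
  patternAlgebra_apply_eq_zero A (fun h => h)

theorem patternAlgebra_inl_inl (A : patternAlgebra K (unfoldRel R I M) hU) {i j : κ}
    (h : ¬ (I i ∧ I j)) : (A : Matrix (κ ⊕ κ) (κ ⊕ κ) K) (.inl i) (.inl j) = 0 :=
  patternAlgebra_apply_eq_zero A h

theorem patternAlgebra_inr_inl (A : patternAlgebra K (unfoldRel R I M) hU) {k i : κ}
    (h : ¬ (M k ∧ I i)) : (A : Matrix (κ ⊕ κ) (κ ⊕ κ) K) (.inr k) (.inl i) = 0 :=
  patternAlgebra_apply_eq_zero A h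

theorem patternAlgebra_inr_inr (A : patternAlgebra K (unfoldRel R I M) hU) {k l : κ}
    (h : ¬ ((M k ∨ ¬ I k) ∧ (M l ∨ ¬ I l))) :
    (A : Matrix (κ ⊕ κ) (κ ⊕ κ) K) (.inr k) (.inr l) = 0 :=
  patternAlgebra_apply_eq_zero A fun hh => h ⟨hh.1, hh.2.1⟩

/-- A functional is normal if it restricts to the trace of the lower left block. -/
def IsNormalForm (f : Module.Dual K (patternAlgebra K (unfoldRel R I M) hU)) : Prop :=
  ∀ A ∈ lowerBlock K hU, f A = ∑ i, (A : Matrix (κ ⊕ κ) (κ ⊕ κ) K) (.inr i) (.inl i)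

/-- The lower left block of ⁅X, A⁆ is X₂₂A₂₁ - A₂₁X₁₁. Pairing with the ideal therefore sees only
the difference of the two diagonal blocks of X. -/
theorem IsNormalForm.apply_lie {f : Module.Dual K (patternAlgebra K (unfoldRel R I M) hU)}
    (hf : IsNormalForm f) (X A : patternAlgebra K (unfoldRel R I M) hU)
    (hA : A ∈ lowerBlock K hU) :
    f ⁅X, A⁆ = ∑ k, ∑ i, ((X : Matrix (κ ⊕ κ) (κ ⊕ κ) K) (.inr i) (.inr k) -
      (X : Matrix (κ ⊕ κ) (κ ⊕ κ) K) (.inl i) (.inl k)) *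
        (A : Matrix (κ ⊕ κ) (κ ⊕ κ) K) (.inr k) (.inl i) := by
  have hmem : ⁅X, A⁆ ∈ lowerBlock K hU := by
    constructor
    · intro i j
      simp [Ring.lie_def, Matrix.mul_apply, Fintype.sum_sum_type, hA.1, patternAlgebra_inl_inr]
    · intro i j
      simp [Ring.lie_def, Matrix.mul_apply, Fintype.sum_sum_type, hA.2, patternAlgebra_inl_inr]
  rw [hf _ hmem]
  simp only [LieSubalgebra.coe_bracket, Ring.lie_def, Matrix.sub_apply, Matrix.mul_apply,
    Fintype.sum_sum_type, hA.1, hA.2, mul_zero, zero_mul, Finset.sum_const_zero, zero_add,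
    add_zero, sub_mul, Finset.sum_sub_distrib]
  congr 1
  · exact Finset.sum_comm
  · refine Finset.sum_congr rfl fun k _ => Finset.sum_congr rfl fun i _ => mul_comm _ _

/-- X is orthogonal to the ideal when its two diagonal blocks agree at all positions (i, k) with i
in I and k in M. Such an X glues to one matrix on κ, and `Unfoldable` makes the gluing inverse,
modulo the ideal, to `unfoldHom`: the glued matrix is supported on R, and a matrix supported on R is
recovered from its two compressions. -/
theorem IsNormalForm.finrank_stabilizer (h : Unfoldable R I M)
    {f : Module.Dual K (patternAlgebra K (unfoldRel R I M) hU)} (hf : IsNormalForm f) :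
    Module.finrank K (coadjointStabilizer K _ f) =
      Module.finrank K (coadjointStabilizer K (patternAlgebra K R hR)
        (f ∘ₗ (unfoldHom K h hR hU : patternAlgebra K R hR →ₗ[K] _))) := by
  have hsingle : ∀ k i (hki : M k ∧ I i), (⟨Matrix.single (.inr k) (.inl i) (1 : K),
      single_mem_patternAlgebra (by exact hki) 1⟩ :
        patternAlgebra K (unfoldRel R I M) hU) ∈ lowerBlock K hU := by
    intro k i hki
    constructor <;> intro a b <;> simp
  have htest : ∀ (X : patternAlgebra K (unfoldRel R I M) hU) k i (hki : M k ∧ I i),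
      f ⁅X, (⟨Matrix.single (.inr k) (.inl i) (1 : K), single_mem_patternAlgebra (by exact hki) 1⟩ :
        patternAlgebra K (unfoldRel R I M) hU)⁆ =
        (X : Matrix (κ ⊕ κ) (κ ⊕ κ) K) (.inr i) (.inr k) -
          (X : Matrix (κ ⊕ κ) (κ ⊕ κ) K) (.inl i) (.inl k) := by
    intro X k i hki
    rw [hf.apply_lie _ _ (hsingle k i hki), Finset.sum_eq_single k, Finset.sum_eq_single i]
    · simp
    · intro b _ hb
      simp [hb.symm]
    · simp
    · intro b _ hb
      simp [hb.symm]
    · simp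
  apply finrank_stabilizer_eq_of_isotropic f (lowerBlock K hU) (unfoldHom K h hR hU)
  · intro Y A hA
    rw [hf.apply_lie _ _ hA]
    refine Finset.sum_eq_zero fun k _ => Finset.sum_eq_zero fun i _ => ?_
    by_cases hki : M k ∧ I i
    swap
    · rw [patternAlgebra_inr_inl A hki, mul_zero]
    have e1 : ((unfoldHom K h hR hU Y : patternAlgebra K (unfoldRel R I M) hU) :
        Matrix (κ ⊕ κ) (κ ⊕ κ) K) (.inr i) (.inr k) =
        compress (fun k => M k ∨ ¬ I k) Y i k := rfl
    have e2 : ((unfoldHom K h hR hU Y : patternAlgebra K (unfoldRel R I M) hU) :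
        Matrix (κ ⊕ κ) (κ ⊕ κ) K) (.inl i) (.inl k) = compress I Y i k := rfl
    rw [e1, e2]
    obtain ⟨hMk, hIi⟩ := hki
    by_cases hIk : I k
    · rw [compress_of hIi hIk]
      by_cases hMi : M i
      · rw [compress_of (p := fun k => M k ∨ ¬ I k) (Or.inl hMi) (Or.inl hMk), sub_self, zero_mul]
      · rw [compress_of_not (fun hh => hh.1.elim hMi (fun g => g hIi)),
          patternAlgebra_apply_eq_zero Y
            (fun hr => (h.right_mem_diff _ _ hr hIi hMi).2 hMk), sub_self, zero_mul]
    · rw [compress_of_not (p := I) (fun hh => hIk hh.2)]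
      have hMi : M i := by
        rcases h.subset_or with h1 | h1
        · exact h1 i hIi
        · exact absurd (h1 k hMk) hIk
      rw [compress_of (p := fun k => M k ∨ ¬ I k) (Or.inl hMi) (Or.inl hMk),
        patternAlgebra_apply_eq_zero Y (fun hr => hIk (h.right_mem _ _ hr hIi hMk)), sub_self,
        zero_mul]
  · intro X hX
    have hSP : ∀ i k, I i → M k → (X : Matrix (κ ⊕ κ) (κ ⊕ κ) K) (.inr i) (.inr k) =
        (X : Matrix (κ ⊕ κ) (κ ⊕ κ) K) (.inl i) (.inl k) := by
      intro i k hi hk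
      have := hX _ (hsingle k i ⟨hk, hi⟩)
      rw [htest X k i ⟨hk, hi⟩] at this
      exact sub_eq_zero.1 this
    classical
    -- The glued matrix takes the right block where it is available and the left block elsewhere on
    -- I.
    let Y : Matrix κ κ K := Matrix.of fun i j =>
      if (M i ∨ ¬ I i) ∧ (M j ∨ ¬ I j) then
        (X : Matrix (κ ⊕ κ) (κ ⊕ κ) K) (.inr i) (.inr j)
      else if I i ∧ I j then (X : Matrix (κ ⊕ κ) (κ ⊕ κ) K) (.inl i) (.inl j) else 0
    have hY : Y ∈ patternAlgebra K R hR := by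
      intro i j hne
      simp only [Y, Matrix.of_apply] at hne
      split_ifs at hne with h1 h2
      · rcases (X.2 _ _ hne : unfoldRel R I M (.inr i) (.inr j)).2.2 with h3 | ⟨h3, h4, h5⟩
        · exact h3
        · rw [hSP i j h3 h4, patternAlgebra_inl_inl X (fun hh => h5 hh.2)] at hne
          exact absurd rfl hne
      · by_cases hMj : M j
        · have hMi : ¬ (M i ∨ ¬ I i) := fun hh => h1 ⟨hh, Or.inl hMj⟩
          rw [← hSP i j h2.1 hMj, patternAlgebra_inr_inr X (fun hh => hMi hh.1)] at hne
          exact absurd rfl hne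
        · exact h.rel_diff _ _ h2.1 h2.2 hMj
      · exact absurd rfl hne
    refine ⟨X - unfoldHom K h hR hU ⟨Y, hY⟩, ⟨?_, ?_⟩, ⟨Y, hY⟩, by abel⟩
    · intro i j
      change (X : Matrix (κ ⊕ κ) (κ ⊕ κ) K) (.inl i) (.inl j) - compress I Y i j = 0
      by_cases hij : I i ∧ I j
      · rw [compress_of hij.1 hij.2]
        simp only [Y, Matrix.of_apply]
        split_ifs with h1
        · rw [hSP i j hij.1 (h1.2.resolve_right (fun g => g hij.2)), sub_self]
        · rw [sub_self]
      · rw [compress_of_not hij, patternAlgebra_inl_inl X hij, sub_self]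
    · intro i j
      change (X : Matrix (κ ⊕ κ) (κ ⊕ κ) K) (.inr i) (.inr j) -
        compress (fun k => M k ∨ ¬ I k) Y i j = 0
      by_cases hij : (M i ∨ ¬ I i) ∧ (M j ∨ ¬ I j)
      · rw [compress_of (p := fun k => M k ∨ ¬ I k) hij.1 hij.2]
        simp only [Y, Matrix.of_apply, if_pos hij, sub_self]
      · rw [compress_of_not hij,
          patternAlgebra_inr_inr X hij, sub_self]
  · rintro ⟨Y, hY⟩ ⟨h1, h2⟩
    apply Subtype.ext
    ext i j
    change Y i j = 0
    have h1' : compress I Y i j = 0 := h1 i j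
    have h2' : compress (fun k => M k ∨ ¬ I k) Y i j = 0 := h2 i j
    by_contra hne
    have hr := hY i j hne
    by_cases hI : I i ∧ I j
    · rw [compress_of hI.1 hI.2] at h1'
      exact hne h1'
    by_cases hQ : (M i ∨ ¬ I i) ∧ (M j ∨ ¬ I j)
    · rw [compress_of (p := fun k => M k ∨ ¬ I k) hQ.1 hQ.2] at h2'
      exact hne h2'
    have a1 := h.right_mem_diff _ _ hr
    have a2 := h.mem_of_rel _ _ hr
    have a3 := h.subset_or
    rcases a3 with a3 | a3
    · have := a3 i
      have := a3 j
      tauto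
    · have := a3 i
      tauto
  · intro A hA hrad
    apply Subtype.ext
    ext x y
    rcases x with i | k <;> rcases y with j | l
    · exact hA.1 i j
    · exact patternAlgebra_inl_inr A i l
    · change (A : Matrix (κ ⊕ κ) (κ ⊕ κ) K) (.inr k) (.inl j) = 0
      by_cases hkj : M k ∧ I j
      swap
      · exact patternAlgebra_inr_inl A hkj
      by_cases hIk : I k
      · have := hrad ⟨Matrix.single (.inl j) (.inl k) (1 : K),
          single_mem_patternAlgebra (by exact ⟨hkj.2, hIk⟩) 1⟩
        rw [hf.apply_lie _ _ hA, Finset.sum_eq_single k, Finset.sum_eq_single j] at this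
        · simpa using this
        · intro b _ hb
          simp [hb.symm]
        · simp
        · intro b _ hb
          simp [hb.symm]
        · simp
      · have hMj : M j := by
          rcases h.subset_or with h1 | h1
          · exact h1 j hkj.2
          · exact absurd (h1 k hkj.1) hIk
        -- For k outside I the left copy has no matrix unit at (j, k); the right copy has one
        -- because of the extra clause in `unfoldRel`.
        have := hrad ⟨Matrix.single (.inr j) (.inr k) (1 : K),
          single_mem_patternAlgebra
            (by exact ⟨Or.inl hMj, Or.inl hkj.1, Or.inr ⟨hkj.2, hkj.1, hIk⟩⟩) 1⟩
        rw [hf.apply_lie _ _ hA, Finset.sum_eq_single k, Finset.sum_eq_single j] at this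
        · simpa using this
        · intro b _ hb
          simp [hb.symm]
        · simp
        · intro b _ hb
          simp [hb.symm]
        · simp
    · exact hA.2 k l

/-- Every form on the folded algebra is the pullback of a normal form: read it off the glued matrix
and add the trace of the lower left block. -/
theorem lieIndex_unfoldRel_le (h : Unfoldable R I M) :
    lieIndex K (patternAlgebra K (unfoldRel R I M) hU) ≤ lieIndex K (patternAlgebra K R hR) := by
  obtain ⟨f', hf'⟩ := exists_finrank_stabilizer_eq_lieIndex K (patternAlgebra K R hR)
  obtain ⟨g, hg⟩ := LinearMap.exists_extend (p := (patternAlgebra K R hR).toSubmodule) f'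
  classical
  let ρ : patternAlgebra K (unfoldRel R I M) hU →ₗ[K] Matrix κ κ K :=
    { toFun := fun X => Matrix.of fun i j =>
        if (M i ∨ ¬ I i) ∧ (M j ∨ ¬ I j) then
          (X : Matrix (κ ⊕ κ) (κ ⊕ κ) K) (.inr i) (.inr j)
        else (X : Matrix (κ ⊕ κ) (κ ⊕ κ) K) (.inl i) (.inl j)
      map_add' := fun A B => by
        ext i j; simp only [Matrix.of_apply, Matrix.add_apply]; split_ifs <;> simp
      map_smul' := fun t A => by
        ext i j
        simp only [Matrix.of_apply, Matrix.smul_apply, RingHom.id_apply]; split_ifs <;> simp }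
  let τ : patternAlgebra K (unfoldRel R I M) hU →ₗ[K] K :=
    { toFun := fun X => ∑ i, (X : Matrix (κ ⊕ κ) (κ ⊕ κ) K) (.inr i) (.inl i)
      map_add' := fun A B => by simp [Finset.sum_add_distrib]
      map_smul' := fun t A => by simp [Finset.mul_sum] }
  have hn : IsNormalForm (g ∘ₗ ρ + τ) := by
    intro A hA
    have h0 : ρ A = 0 := by
      ext i j
      simp [ρ, hA.1, hA.2]
    simp [h0, τ]
  have hc : (g ∘ₗ ρ + τ) ∘ₗ (unfoldHom K h hR hU : patternAlgebra K R hR →ₗ[K] _) = f' := by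
    ext Y
    have h0 : ρ (unfoldHom K h hR hU Y) = Y := by
      ext i j
      change (if (M i ∨ ¬ I i) ∧ (M j ∨ ¬ I j) then
          compress (fun k => M k ∨ ¬ I k) (Y : Matrix κ κ K) i j
        else compress I (Y : Matrix κ κ K) i j) = (Y : Matrix κ κ K) i j
      split_ifs with hQ
      · exact compress_of (p := fun k => M k ∨ ¬ I k) hQ.1 hQ.2
      · by_cases hI : I i ∧ I j
        · exact compress_of hI.1 hI.2
        · rw [compress_of_not hI]
          by_contra hne
          have hr := Y.2 i j (fun h => hne h.symm)
          have a1 := h.right_mem_diff _ _ hr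
          have a2 := h.mem_of_rel _ _ hr
          rcases h.subset_or with a3 | a3
          · have := a3 i
            have := a3 j
            tauto
          · have := a3 i
            tauto
    have h1 : τ (unfoldHom K h hR hU Y) = 0 := Finset.sum_eq_zero fun i _ => rfl
    have h2 : g Y = f' Y := LinearMap.congr_fun hg Y
    change g (ρ (unfoldHom K h hR hU Y)) + τ (unfoldHom K h hR hU Y) = f' Y
    rw [h0, h1, add_zero, h2]
  rw [← hf', ← hc, ← hn.finrank_stabilizer h]
  exact lieIndex_le _

end Fold

/-! ### Bringing a generic linear form to normal form. -/

section Normalize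

/-- Here P, m and δ stand for the projectors to I, M and I ∩ M, G for the matrix of the form on the
ideal, and V for the inverse of the corner δGδ. This identity and the next exhibit inverses of the
two diagonal blocks of the conjugating matrix. -/
theorem clear_left_mul_inv {A : Type*} [Ring A] {P δ V G : A} (hδP : δ * P = δ)
    (hδV : δ * V = V) (hGV : δ * G * V = δ) :
    (1 - δ + P * G * δ) * (1 + V - P * G * V) = 1 := by
  have e : ∀ X, δ * (P * X) = δ * X := fun X => by rw [← mul_assoc, hδP]
  rw [mul_assoc] at hGV
  simp only [mul_add, add_mul, mul_sub, sub_mul, mul_assoc, one_mul, mul_one, hδV, e, hGV]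
  abel

theorem clear_right_mul_inv {A : Type*} [Ring A] {m δ V G : A} (hmδ : m * δ = δ)
    (hmV : m * V = V) (hδδ : δ * δ = δ) (hδV : δ * V = V) (hVG : V * G * δ = δ) :
    (1 + δ - V * G * m) * (1 - δ + V * G * m) = 1 := by
  have e1 : ∀ X, m * (V * X) = V * X := fun X => by rw [← mul_assoc, hmV]
  have e2 : ∀ X, δ * (V * X) = V * X := fun X => by rw [← mul_assoc, hδV]
  rw [mul_assoc] at hVG
  have e3 : ∀ X, V * (G * (V * X)) = V * X := fun X => by
    calc V * (G * (V * X)) = V * (G * (δ * V * X)) := by rw [hδV]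
      _ = V * (G * δ) * (V * X) := by simp only [mul_assoc]
      _ = V * X := by rw [hVG, e2]
  simp only [mul_add, add_mul, mul_sub, sub_mul, mul_assoc, one_mul, mul_one, hmδ, e1, e2, e3,
    hVG, hδδ]
  abel

/-- Block Gaussian elimination turns the relevant corner PGm into δ. If I ⊆ M, the left factor
inverts δGδ and the right factor clears the columns in M ∖ I; if M ⊆ I, the left factor alone
suffices, since VGm = δ. -/
theorem clear_both {A : Type*} [Ring A] {P m δ V G : A} (hPP : P * P = P) (hδδ : δ * δ = δ)
    (hmδ : m * δ = δ) (hmm : m * m = m) (hδm : δ * m = δ) (hPV : P * V = V) (hδV : δ * V = V) (hGV : δ * G * V = δ)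
    (hVG : V * G * δ = δ) (h : P = δ ∨ m = δ) :
    P * (1 + V - P * G * V) * G * (1 + δ - V * G * m) * m = δ := by
  have e2 : ∀ X, δ * (V * X) = V * X := fun X => by rw [← mul_assoc, hδV]
  have e4 : ∀ X, δ * (G * (V * X)) = δ * X := fun X => by
    rw [← mul_assoc G, ← mul_assoc, ← mul_assoc δ, hGV]
  have e5 : ∀ X, P * (P * X) = P * X := fun X => by rw [← mul_assoc, hPP]
  have e6 : ∀ X, V * (G * (δ * X)) = δ * X := fun X => by
    rw [← mul_assoc, ← mul_assoc, hVG]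
  have e7 : ∀ X, δ * (m * X) = δ * X := fun X => by rw [← mul_assoc, hδm]
  have e8 : ∀ X, δ * (δ * X) = δ * X := fun X => by rw [← mul_assoc, hδδ]
  have e3 : ∀ X, V * (G * (V * X)) = V * X := fun X => by
    calc V * (G * (V * X)) = V * (G * (δ * V * X)) := by rw [hδV]
      _ = V * G * δ * (V * X) := by simp only [mul_assoc]
      _ = V * X := by rw [hVG, e2]
  rw [mul_assoc] at hVG hGV
  rcases h with rfl | rfl
  · simp only [mul_add, add_mul, mul_sub, sub_mul, mul_assoc, mul_one, hmm, hδm, hVG,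
      e3, e4, e8, hδV]
    abel
  · simp only [mul_add, add_mul, mul_sub, sub_mul, mul_assoc, mul_one, hmm, hVG, e5, hPV]
    abel

variable {κ : Type*} [Fintype κ] [DecidableEq κ] {K : Type*} [Field K]
  {R : κ → κ → Prop} {hR : ∀ i j k, R i j → R j k → R i k} {I M : κ → Prop}
  {hU : ∀ x y z, unfoldRel R I M x y → unfoldRel R I M y z → unfoldRel R I M x z}

open Classical in
/-- The diagonal projector to the positions satisfying a predicate. -/
noncomputable def diagProj (K : Type*) [Field K] (p : κ → Prop) : Matrix κ κ K :=
  Matrix.diagonal fun i => if p i then 1 else 0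

theorem diagProj_mul_diagProj (p q : κ → Prop) :
    diagProj K p * diagProj K q = diagProj K fun i => p i ∧ q i := by
  rw [diagProj, diagProj, diagProj, Matrix.diagonal_mul_diagonal]
  congr 1
  ext i
  by_cases hp : p i <;> by_cases hq : q i <;> simp [hp, hq]

theorem diagProj_mul_apply (p : κ → Prop) (A : Matrix κ κ K) (i j : κ) (hi : ¬ p i) :
    (diagProj K p * A) i j = 0 := by
  simp [diagProj, Matrix.diagonal_mul, hi]

theorem mul_diagProj_apply (p : κ → Prop) (A : Matrix κ κ K) (i j : κ) (hj : ¬ p j) :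
    (A * diagProj K p) i j = 0 := by
  simp [diagProj, Matrix.mul_diagonal, hj]

theorem diagProj_mul_eq_self {p : κ → Prop} {A : Matrix κ κ K} (h : ∀ i j, A i j ≠ 0 → p i) :
    diagProj K p * A = A := by
  ext i j
  by_cases hi : p i
  · simp [diagProj, Matrix.diagonal_mul, hi]
  · rw [diagProj_mul_apply _ _ _ _ hi]
    by_contra hne
    exact hi (h i j (Ne.symm hne))

theorem mul_diagProj_eq_self {p : κ → Prop} {A : Matrix κ κ K} (h : ∀ i j, A i j ≠ 0 → p j) :
    A * diagProj K p = A := by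
  ext i j
  by_cases hj : p j
  · simp [diagProj, Matrix.mul_diagonal, hj]
  · rw [mul_diagProj_apply _ _ _ _ hj]
    by_contra hne
    exact hj (h i j (Ne.symm hne))

/-- The trace of the lower left block. -/
noncomputable def lowerTrace (K : Type*) [Field K]
    (hU : ∀ x y z, unfoldRel R I M x y → unfoldRel R I M y z → unfoldRel R I M x z) :
    Module.Dual K (patternAlgebra K (unfoldRel R I M) hU) where
  toFun X := ∑ i, (X : Matrix (κ ⊕ κ) (κ ⊕ κ) K) (.inr i) (.inl i)
  map_add' A B := by simp [Finset.sum_add_distrib]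
  map_smul' t A := by simp [Finset.mul_sum]

theorem exists_trace_mul_lowerBlock
    (f : Module.Dual K (patternAlgebra K (unfoldRel R I M) hU)) :
    ∃ G : Matrix κ κ K, ∀ A ∈ lowerBlock K hU,
      f A = (G * (A : Matrix (κ ⊕ κ) (κ ⊕ κ) K).toBlocks₂₁).trace := by
  obtain ⟨F, hF⟩ := LinearMap.exists_extend
    (p := (patternAlgebra K (unfoldRel R I M) hU).toSubmodule) f
  refine ⟨Matrix.of fun i k => F (Matrix.single (.inr k) (.inl i) 1), fun A hA => ?_⟩
  have h1 : F (A : Matrix (κ ⊕ κ) (κ ⊕ κ) K) = f A := LinearMap.congr_fun hF A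
  have h2 : ∀ (x y : κ ⊕ κ) (a : K), F (Matrix.single x y a) = a * F (Matrix.single x y 1) := by
    intro x y a
    rw [← smul_eq_mul, ← map_smul, Matrix.smul_single, smul_eq_mul, mul_one]
  have h3 : F (A : Matrix (κ ⊕ κ) (κ ⊕ κ) K) = ∑ x, ∑ y,
      (A : Matrix (κ ⊕ κ) (κ ⊕ κ) K) x y * F (Matrix.single x y 1) := by
    conv_lhs => rw [Matrix.matrix_eq_sum_single (A : Matrix (κ ⊕ κ) (κ ⊕ κ) K)]
    rw [map_sum]
    refine Finset.sum_congr rfl fun x _ => ?_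
    rw [map_sum]
    exact Finset.sum_congr rfl fun y _ => h2 x y _
  rw [← h1, h3]
  simp only [Fintype.sum_sum_type, hA.1, hA.2, patternAlgebra_inl_inr, zero_mul,
    Finset.sum_const_zero, zero_add, add_zero, Matrix.trace, Matrix.diag, Matrix.mul_apply,
    Matrix.of_apply]
  rw [Finset.sum_comm]
  refine Finset.sum_congr rfl fun i _ => Finset.sum_congr rfl fun k _ => ?_
  rw [mul_comm]
  rfl

theorem finite_setOf_not_isUnit_add_smul_one (A : Matrix κ κ K) :
    {t : K | ¬ IsUnit (A + t • (1 : Matrix κ κ K))}.Finite := by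
  apply ((Matrix.finite_spectrum A).image (fun z => -z)).subset
  intro t ht
  refine ⟨-t, ?_, by simp⟩
  rw [spectrum.mem_iff]
  intro hu
  apply ht
  have : A + t • (1 : Matrix κ κ K) = -(algebraMap K (Matrix κ κ K) (-t) - A) := by
    rw [Algebra.algebraMap_eq_smul_one]
    simp
  rw [this]
  exact hu.neg

/-- Every functional has a nearby functional that is conjugate to a normal one. -/
theorem exists_isNormalForm_finrank_le [Infinite K] (h : Unfoldable R I M)
    (f₀ : Module.Dual K (patternAlgebra K (unfoldRel R I M) hU)) :
    ∃ f : Module.Dual K (patternAlgebra K (unfoldRel R I M) hU), IsNormalForm f ∧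
      Module.finrank K (coadjointStabilizer K _ f) ≤
        Module.finrank K (coadjointStabilizer K _ f₀) := by
  obtain ⟨G₀, hG₀⟩ := exists_trace_mul_lowerBlock f₀
  set P := diagProj K I with hP
  set m := diagProj K M with hm
  set δ := diagProj K (fun i => I i ∧ M i) with hδ
  -- Adding t times the lower trace replaces G₀ by G₀ + t. Outside finitely many t the I ∩ M corner
  -- is invertible and the stabilizer has not grown.
  obtain ⟨t, ht⟩ := ((finite_setOf_not_isUnit_add_smul_one (δ * G₀ * δ)).union
    (finite_setOf_finrank_stabilizer_lt f₀ (lowerTrace K hU))).exists_notMem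
  simp only [Set.mem_union, Set.mem_ofPred_eq, not_or, not_not, not_lt] at ht
  obtain ⟨⟨W, hW⟩, hle⟩ := ht
  set G := G₀ + t • (1 : Matrix κ κ K) with hG
  have hf : ∀ A ∈ lowerBlock K hU, (f₀ + t • lowerTrace K hU) A =
      (G * (A : Matrix (κ ⊕ κ) (κ ⊕ κ) K).toBlocks₂₁).trace := by
    intro A hA
    rw [LinearMap.add_apply, hG₀ A hA, hG, add_mul, Matrix.trace_add, Matrix.smul_mul, one_mul,
      Matrix.trace_smul]
    rfl
  have hPδ : P * δ = δ := by rw [hP, hδ, diagProj_mul_diagProj]; congr 1; ext i; tauto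
  have hδP : δ * P = δ := by rw [hP, hδ, diagProj_mul_diagProj]; congr 1; ext i; tauto
  have hmδ : m * δ = δ := by rw [hm, hδ, diagProj_mul_diagProj]; congr 1; ext i; tauto
  have hδm : δ * m = δ := by rw [hm, hδ, diagProj_mul_diagProj]; congr 1; ext i; tauto
  have hδδ : δ * δ = δ := by rw [hδ, diagProj_mul_diagProj]; congr 1; ext i; tauto
  have hmm : m * m = m := by rw [hm, diagProj_mul_diagProj]; congr 1; ext i; tauto
  have hPP : P * P = P := by rw [hP, diagProj_mul_diagProj]; congr 1; ext i; tauto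
  have hPm : P * m = δ := by rw [hP, hm, hδ, diagProj_mul_diagProj]
  have hor : P = δ ∨ m = δ := by
    rcases h.subset_or with h1 | h1
    · left; rw [hP, hδ]; congr 1; ext i; have := h1 i; tauto
    · right; rw [hm, hδ]; congr 1; ext i; have := h1 i; tauto
  have hδW : δ * (W : Matrix κ κ K) = δ * G * δ := by
    rw [hW, hG]
    simp only [mul_add, add_mul, Matrix.mul_smul, Matrix.smul_mul, mul_one, hδδ]
    rw [← mul_assoc, ← mul_assoc, hδδ]
  have hWδ : (W : Matrix κ κ K) * δ = δ * G * δ := by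
    rw [hW, hG]
    simp only [mul_add, add_mul, Matrix.mul_smul, Matrix.smul_mul, mul_one, one_mul, hδδ]
    rw [mul_assoc, hδδ]
  set V : Matrix κ κ K := δ * (W⁻¹ : (Matrix κ κ K)ˣ) * δ with hV
  have hδV : δ * V = V := by rw [hV, ← mul_assoc, ← mul_assoc, hδδ]
  have hVδ : V * δ = V := by rw [hV, mul_assoc, hδδ]
  have hVG : V * G * δ = δ := by
    calc V * G * δ = δ * (W⁻¹ : (Matrix κ κ K)ˣ) * (δ * G * δ) := by
          rw [hV]; simp only [mul_assoc]
      _ = δ * ((W⁻¹ : (Matrix κ κ K)ˣ) * (W : Matrix κ κ K)) * δ := by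
          rw [← hWδ]; simp only [mul_assoc]
      _ = δ := by rw [Units.inv_mul, mul_one, hδδ]
  have hGV : δ * G * V = δ := by
    calc δ * G * V = (δ * G * δ) * (W⁻¹ : (Matrix κ κ K)ˣ) * δ := by
          rw [hV]; simp only [mul_assoc]
      _ = δ * ((W : Matrix κ κ K) * (W⁻¹ : (Matrix κ κ K)ˣ)) * δ := by
          rw [← hδW]; simp only [mul_assoc]
      _ = δ := by rw [Units.mul_inv, mul_one, hδδ]
  have hPV : P * V = V := by rw [← hδV, ← mul_assoc, hPδ]
  have hmV : m * V = V := by rw [← hδV, ← mul_assoc, hmδ]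
  have hVP : V * P = V := by rw [← hVδ, mul_assoc, hδP]
  have hw1 := clear_left_mul_inv (P := P) hδP hδV hGV
  have hw2 := clear_right_mul_inv (m := m) hmδ hmV hδδ hδV hVG
  have hw3 := clear_both hPP hδδ hmδ hmm hδm hPV hδV hGV hVG hor
  set w₁ := 1 - δ + P * G * δ with hw₁
  set u₁ := 1 + V - P * G * V with hu₁
  set w₂ := 1 + δ - V * G * m with hw₂
  set u₂ := 1 - δ + V * G * m with hu₂
  -- Conjugation must preserve the algebra. On the right copy it uses entries from I ∩ M to M ∖ I,
  -- which the extra clause of `unfoldRel` admits.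
  have mem : ∀ a b : Matrix κ κ K, (∀ i j, (a - 1) i j ≠ 0 → I i ∧ I j) →
      (∀ i j, (b - 1) i j ≠ 0 → I i ∧ M i ∧ M j ∧ ¬ I j) →
      Matrix.fromBlocks a 0 0 b - 1 ∈ patternAlgebra K (unfoldRel R I M) hU := by
    intro a b ha hb
    rw [← Matrix.fromBlocks_one, sub_eq_add_neg, Matrix.fromBlocks_neg, Matrix.fromBlocks_add,
      ← sub_eq_add_neg a, ← sub_eq_add_neg b]
    rintro (i | i) (j | j) hne
    · exact ha i j hne
    · simp at hne
    · simp at hne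
    · have := hb i j hne
      exact ⟨Or.inl this.2.1, Or.inl this.2.2.1, Or.inr ⟨this.1, this.2.2⟩⟩
  have memI : ∀ a : Matrix κ κ K, P * a = a → a * P = a → ∀ i j, a i j ≠ 0 → I i ∧ I j := by
    intro a h1 h2 i j hne
    constructor
    · by_contra hi
      rw [← h1] at hne
      exact hne (diagProj_mul_apply I a i j hi)
    · by_contra hj
      rw [← h2] at hne
      exact hne (mul_diagProj_apply I a i j hj)
  have memM : ∀ a : Matrix κ κ K, δ * a = a → a * m = a → a * δ = 0 →
      ∀ i j, a i j ≠ 0 → I i ∧ M i ∧ M j ∧ ¬ I j := by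
    intro a h1 h2 h0 i j hne
    have h3 : I i ∧ M i := by
      by_contra hi
      rw [← h1] at hne
      exact hne (diagProj_mul_apply _ a i j hi)
    have h4 : M j := by
      by_contra hj
      rw [← h2] at hne
      exact hne (mul_diagProj_apply M a i j hj)
    have h5 : ¬ I j := by
      intro hj
      apply hne
      have := congrFun (congrFun h0 i) j
      simpa [hδ, diagProj, Matrix.mul_diagonal, hj, h4] using this
    exact ⟨h3.1, h3.2, h4, h5⟩
  obtain ⟨φ, hφ⟩ := exists_conj_patternAlgebra (K := K) (R := unfoldRel R I M) (hR := hU)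
    (w := Matrix.fromBlocks w₁ 0 0 w₂) (w' := Matrix.fromBlocks u₁ 0 0 u₂)
    (by
      rw [Matrix.fromBlocks_multiply]
      simp [hw1, hw2])
    (by
      apply mem
      · have e : w₁ - 1 = P * G * δ - δ := by rw [hw₁]; abel
        rw [e]
        apply memI
        · simp only [mul_sub, ← mul_assoc, hPP, hPδ]
        · simp only [sub_mul, mul_assoc, hδP]
      · have e : w₂ - 1 = δ - V * G * m := by rw [hw₂]; abel
        rw [e]
        apply memM
        · simp only [mul_sub, ← mul_assoc, hδδ, hδV]
        · simp only [sub_mul, mul_assoc, hδm, hmm]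
        · rw [sub_mul, mul_assoc _ m, hmδ, hδδ, hVG, sub_self])
    (by
      apply mem
      · have e : u₁ - 1 = V - P * G * V := by rw [hu₁]; abel
        rw [e]
        apply memI
        · simp only [mul_sub, ← mul_assoc, hPP, hPV]
        · simp only [sub_mul, mul_assoc, hVP]
      · have e : u₂ - 1 = V * G * m - δ := by rw [hu₂]; abel
        rw [e]
        apply memM
        · simp only [mul_sub, ← mul_assoc, hδδ, hδV]
        · simp only [sub_mul, mul_assoc, hδm, hmm]
        · rw [sub_mul, mul_assoc _ m, hmδ, hδδ, hVG, sub_self])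
  refine ⟨(f₀ + t • lowerTrace K hU) ∘ₗ (φ : _ →ₗ[K] _), ?_, ?_⟩
  · intro A hA
    have hA0 : (A : Matrix (κ ⊕ κ) (κ ⊕ κ) K) = Matrix.fromBlocks 0 0
        (A : Matrix (κ ⊕ κ) (κ ⊕ κ) K).toBlocks₂₁ 0 := by
      ext (i | i) (j | j)
      · exact hA.1 i j
      · exact patternAlgebra_inl_inr A i j
      · rfl
      · exact hA.2 i j
    set B := (A : Matrix (κ ⊕ κ) (κ ⊕ κ) K).toBlocks₂₁ with hB
    have hφA : (φ A : Matrix (κ ⊕ κ) (κ ⊕ κ) K) = Matrix.fromBlocks 0 0 (w₂ * B * u₁) 0 := by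
      rw [hφ, hA0, Matrix.fromBlocks_multiply, Matrix.fromBlocks_multiply]
      simp
    have hφmem : φ A ∈ lowerBlock K hU := by
      constructor <;> intro i j <;> rw [hφA] <;> rfl
    have hmB : m * B = B := diagProj_mul_eq_self fun i j hne => by
      by_contra hi
      exact hne (patternAlgebra_inr_inl A fun hh => hi hh.1)
    have hBP : B * P = B := mul_diagProj_eq_self fun i j hne => by
      by_contra hi
      exact hne (patternAlgebra_inr_inl A fun hh => hi hh.2)
    change (f₀ + t • lowerTrace K hU) (φ A) = B.trace
    rw [hf _ hφmem, hφA, Matrix.toBlocks_fromBlocks₂₁]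
    calc (G * (w₂ * B * u₁)).trace = (G * (w₂ * (m * (B * P)) * u₁)).trace := by rw [hBP, hmB]
      _ = ((G * w₂ * m * B) * (P * u₁)).trace := by simp only [mul_assoc]
      _ = ((P * u₁) * (G * w₂ * m * B)).trace := Matrix.trace_mul_comm _ _
      _ = (P * u₁ * G * w₂ * m * B).trace := by simp only [mul_assoc]
      _ = (P * (m * B)).trace := by rw [hw3, ← hPm, mul_assoc]
      _ = (B * P).trace := by rw [hmB, Matrix.trace_mul_comm]
      _ = B.trace := by rw [hBP]
  · rw [finrank_stabilizer_comp_equiv]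
    exact hle

theorem lieIndex_unfoldRel [Infinite K] (h : Unfoldable R I M) :
    lieIndex K (patternAlgebra K (unfoldRel R I M) hU) = lieIndex K (patternAlgebra K R hR) := by
  apply le_antisymm (lieIndex_unfoldRel_le h)
  refine le_lieIndex fun f₀ => ?_
  obtain ⟨f, hf, hle⟩ := exists_isNormalForm_finrank_le h f₀
  rw [hf.finrank_stabilizer (hR := hR) h] at hle
  exact (lieIndex_le _).trans hle

end Normalize

/-! ### The index of gl_a, and splitting off a full block. -/

section FullBlock

theorem exists_trace_mul_eq {K : Type*} [Field K] {ι : Type*} [Fintype ι] [DecidableEq ι]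
    (f : Module.Dual K (Matrix ι ι K)) : ∃ F : Matrix ι ι K, ∀ X, f X = (F * X).trace := by
  refine ⟨Matrix.of fun i j => f (Matrix.single j i 1), fun X => ?_⟩
  conv_lhs => rw [Matrix.matrix_eq_sum_single X]
  simp only [map_sum, Matrix.trace, Matrix.diag, Matrix.mul_apply, Matrix.of_apply]
  rw [Finset.sum_comm]
  refine Finset.sum_congr rfl fun i _ => Finset.sum_congr rfl fun j _ => ?_
  rw [mul_comm, ← smul_eq_mul, ← map_smul, Matrix.smul_single, smul_eq_mul, mul_one]

theorem matrix_eq_of_trace_mul {K : Type*} [Field K] {ι : Type*} [Fintype ι] [DecidableEq ι]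
    {A : Matrix ι ι K} (h : ∀ X, (A * X).trace = 0) : A = 0 := by
  ext i j
  have := h (Matrix.single j i 1)
  simpa [Matrix.trace_mul_single] using this

theorem det_diag_pow_vandermonde {K : Type*} [Field K] {a : ℕ} (d : Fin a → K) :
    (Matrix.of fun j i : Fin a => ((Matrix.diagonal d : Matrix (Fin a) (Fin a) K) ^ (j : ℕ)) i i) =
      (Matrix.vandermonde d).transpose := by
  ext j i
  simp [Matrix.diagonal_pow, Matrix.vandermonde]

/-- The determinant is a polynomial in s, and at s = 0 it is the Vandermonde determinant of the
distinct d i. Where it is nonzero, the first a powers of the matrix are linearly independent. -/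
theorem finite_setOf_det_diag_pow_eq_zero {K : Type*} [Field K] {a : ℕ} {d : Fin a → K}
    (hd : Function.Injective d) (F : Matrix (Fin a) (Fin a) K) :
    {s : K | (Matrix.of fun j i : Fin a =>
      ((Matrix.diagonal d + s • F) ^ (j : ℕ)) i i).det = 0}.Finite := by
  let E : Matrix (Fin a) (Fin a) (Polynomial K) :=
    (Matrix.diagonal d).map (Polynomial.C : K →+* _) +
      (Polynomial.X : Polynomial K) • F.map (Polynomial.C : K →+* _)
  let q : Polynomial K := (Matrix.of fun j i : Fin a => (E ^ (j : ℕ)) i i).det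
  have heval : ∀ s, q.eval s = (Matrix.of fun j i : Fin a =>
      ((Matrix.diagonal d + s • F) ^ (j : ℕ)) i i).det := by
    intro s
    have hE : (Polynomial.evalRingHom s).mapMatrix E = Matrix.diagonal d + s • F := by
      ext i j
      by_cases hij : i = j
      · subst hij
        simp [E, mul_comm s]
      · simp [E, hij, mul_comm s]
    rw [← Polynomial.coe_evalRingHom, RingHom.map_det]
    congr 1
    ext j i
    have h := map_pow (Polynomial.evalRingHom s).mapMatrix E (j : ℕ)
    rw [hE] at h
    exact congrFun (congrFun h i) i
  have hq : q ≠ 0 := by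
    intro h0
    have := heval 0
    rw [h0, zero_smul, add_zero, det_diag_pow_vandermonde, Matrix.det_transpose,
      Polynomial.eval_zero] at this
    exact Matrix.det_vandermonde_ne_zero_iff.2 hd this.symm
  refine (Polynomial.finite_setOfPred_isRoot hq).subset fun s hs => ?_
  exact (heval s).trans hs

/-- Under the trace pairing, stabilizers are centralizers. A diagonal matrix with distinct entries
has centralizer of dimension at most a; conversely, any form can be perturbed, without enlarging its
stabilizer, to one whose centralizer contains a independent powers. -/
theorem lieIndex_matrix (K : Type*) [Field K] [Infinite K] (a : ℕ) :
    lieIndex K (Matrix (Fin a) (Fin a) K) = a := by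
  let d : Fin a → K := fun i => Infinite.natEmbedding K i
  have hd : Function.Injective d :=
    (Infinite.natEmbedding K).injective.comp Fin.val_injective
  let tr : Matrix (Fin a) (Fin a) K → Module.Dual K (Matrix (Fin a) (Fin a) K) :=
    fun F => Matrix.traceLinearMap (Fin a) K K ∘ₗ LinearMap.mulLeft K F
  have htr : ∀ F X, X ∈ coadjointStabilizer K _ (tr F) ↔ F * X = X * F := by
    intro F X
    rw [mem_coadjointStabilizer]
    have e : ∀ Y, tr F ⁅X, Y⁆ = ((F * X - X * F) * Y).trace := by
      intro Y
      simp only [tr, LinearMap.comp_apply, LinearMap.mulLeft_apply, Matrix.traceLinearMap_apply,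
        Ring.lie_def, mul_sub, sub_mul, Matrix.trace_sub, ← mul_assoc]
      congr 1
      rw [Matrix.trace_mul_comm, ← mul_assoc]
    simp only [e]
    constructor
    · intro h
      exact sub_eq_zero.1 (matrix_eq_of_trace_mul h)
    · intro h Y
      rw [h, sub_self, zero_mul, Matrix.trace_zero]
  apply le_antisymm
  · refine (lieIndex_le (tr (Matrix.diagonal d))).trans ?_
    have hinj : Function.Injective ((Matrix.diagLinearMap (Fin a) K K).domRestrict
        (coadjointStabilizer K _ (tr (Matrix.diagonal d)))) := by
      rw [injective_iff_map_eq_zero]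
      rintro ⟨X, hX⟩ h0
      apply Subtype.ext
      ext i j
      rw [htr] at hX
      by_cases hij : i = j
      · subst hij
        exact congrFun h0 i
      · have := congrFun (congrFun hX i) j
        rw [Matrix.diagonal_mul, Matrix.mul_diagonal, mul_comm, ← sub_eq_zero, ← mul_sub] at this
        exact (mul_eq_zero.1 this).resolve_right (sub_ne_zero.2 fun h => hij (hd h))
    simpa using LinearMap.finrank_le_finrank_of_injective hinj
  · refine le_lieIndex fun f₀ => ?_
    obtain ⟨F₀, hF₀⟩ := exists_trace_mul_eq f₀
    obtain ⟨t, ht⟩ := (((finite_setOf_det_diag_pow_eq_zero hd F₀).image (fun s => s⁻¹)).union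
      ((finite_setOf_finrank_stabilizer_lt f₀ (tr (Matrix.diagonal d))).union
        (Set.finite_singleton 0))).exists_notMem
    simp only [Set.mem_union, Set.mem_image, Set.mem_ofPred_eq, Set.mem_singleton_iff, not_or,
      not_lt, not_exists, not_and] at ht
    obtain ⟨h1, h2, h3⟩ := ht
    have hdet := fun h => h1 t⁻¹ h (inv_inv t)
    refine le_trans ?_ h2
    have hf : f₀ + t • tr (Matrix.diagonal d) = tr (F₀ + t • Matrix.diagonal d) := by
      ext X : 1
      simp [hF₀, tr, add_mul]
    rw [hf]
    -- The factor t ≠ 0 does not affect the centralizer, and s = t⁻¹ avoids the bad set of the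
    -- determinant.
    have hE : F₀ + t • Matrix.diagonal d = t • (Matrix.diagonal d + t⁻¹ • F₀) := by
      rw [smul_add, smul_smul, mul_inv_cancel₀ h3, one_smul, add_comm]
    rw [hE]
    let v : Fin a → coadjointStabilizer K _ (tr (t • (Matrix.diagonal d + t⁻¹ • F₀))) :=
      fun j => ⟨(Matrix.diagonal d + t⁻¹ • F₀) ^ (j : ℕ), by
        rw [htr, Matrix.smul_mul, Matrix.mul_smul, ← pow_succ, ← pow_succ']⟩
    have hv : LinearIndependent K v := by
      apply LinearIndependent.of_comp ((Matrix.diagLinearMap (Fin a) K K).domRestrict _)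
      exact Matrix.linearIndependent_rows_of_det_ne_zero hdet
    simpa using hv.fintype_card_le_finrank

/-- The relation on a disjoint sum with a full block on the left. -/
def fullSumRel {α ι : Type*} (R : ι → ι → Prop) : α ⊕ ι → α ⊕ ι → Prop
  | .inl _, .inl _ => True
  | .inr i, .inr j => R i j
  | _, _ => False

theorem lieIndex_fullSumRel {K : Type*} [Field K] [Infinite K] {a : ℕ} {ι : Type*} [Fintype ι]
    [DecidableEq ι] {R : ι → ι → Prop} {hR : ∀ i j k, R i j → R j k → R i k}
    {hS : ∀ i j k, fullSumRel (α := Fin a) R i j → fullSumRel (α := Fin a) R j k →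
      fullSumRel (α := Fin a) R i k} :
    lieIndex K (patternAlgebra K (fullSumRel (α := Fin a) R) hS) =
      a + lieIndex K (patternAlgebra K R hR) := by
  let φ : Matrix (Fin a) (Fin a) K × patternAlgebra K R hR →ₗ⁅K⁆
      patternAlgebra K (fullSumRel (α := Fin a) R) hS :=
    { toFun := fun p => ⟨Matrix.fromBlocks p.1 0 0 p.2, by
        rintro (i | i) (j | j) hne
        · trivial
        · simp at hne
        · simp at hne
        · exact p.2.2 i j hne⟩
      map_add' := fun p q => by
        apply Subtype.ext
        change Matrix.fromBlocks (p.1 + q.1) 0 0 ((p.2 : Matrix ι ι K) + (q.2 : Matrix ι ι K)) =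
          Matrix.fromBlocks p.1 0 0 (p.2 : Matrix ι ι K) +
          Matrix.fromBlocks q.1 0 0 (q.2 : Matrix ι ι K)
        rw [Matrix.fromBlocks_add, add_zero, add_zero]
      map_smul' := fun t p => by
        apply Subtype.ext
        change Matrix.fromBlocks (t • p.1) 0 0 (t • (p.2 : Matrix ι ι K)) =
          t • Matrix.fromBlocks p.1 0 0 (p.2 : Matrix ι ι K)
        rw [Matrix.fromBlocks_smul, smul_zero, smul_zero]
      map_lie' := by
        intro p q
        apply Subtype.ext
        simp only [LieSubalgebra.coe_bracket, Ring.lie_def, LieAlgebra.Prod.bracket_apply,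
          Matrix.fromBlocks_multiply]
        rw [sub_eq_add_neg (Matrix.fromBlocks _ _ _ _), Matrix.fromBlocks_neg,
          Matrix.fromBlocks_add]
        simp [sub_eq_add_neg] }
  have hφ : Function.Bijective φ := by
    constructor
    · rintro ⟨A, B⟩ ⟨A', B'⟩ h
      have h' : Matrix.fromBlocks A 0 0 (B : Matrix ι ι K) =
        Matrix.fromBlocks A' 0 0 (B' : Matrix ι ι K) := congrArg Subtype.val h
      rw [Matrix.fromBlocks_inj] at h'
      rw [Prod.mk.injEq]
      exact ⟨h'.1, Subtype.ext h'.2.2.2⟩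
    · intro X
      refine ⟨⟨(X : Matrix (Fin a ⊕ ι) (Fin a ⊕ ι) K).toBlocks₁₁,
        ⟨(X : Matrix (Fin a ⊕ ι) (Fin a ⊕ ι) K).toBlocks₂₂, fun i j hne => X.2 _ _ hne⟩⟩, ?_⟩
      apply Subtype.ext
      ext (i | i) (j | j)
      · rfl
      · exact (patternAlgebra_apply_eq_zero X (i := .inl i) (j := .inr j) (fun h => h)).symm
      · exact (patternAlgebra_apply_eq_zero X (i := .inr i) (j := .inl j) (fun h => h)).symm
      · rfl
  rw [← lieIndex_congr (LieEquiv.ofBijective φ hφ), lieIndex_prod, lieIndex_matrix]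

end FullBlock

/-! ### Seaweed algebras indexed by lists of block sizes. -/

section Lists

/-- Two positions lie in the same block of the list `l` of block sizes. -/
def SameBlock (l : List ℕ) (i j : ℕ) : Prop :=
  ∀ k, (l.take k).sum ≤ i ↔ (l.take k).sum ≤ j

theorem SameBlock.symm {l : List ℕ} {i j : ℕ} (h : SameBlock l i j) : SameBlock l j i :=
  fun k => (h k).symm

theorem SameBlock.trans {l : List ℕ} {i j k : ℕ} (h : SameBlock l i j) (h' : SameBlock l j k) :
    SameBlock l i k := fun m => (h m).trans (h' m)

theorem SameBlock.left {l : List ℕ} {i j k : ℕ} (h : SameBlock l i k) (hij : i ≤ j)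
    (hjk : j ≤ k) : SameBlock l i j :=
  fun m => ⟨fun hm => hm.trans hij, fun hm => (h m).2 (hm.trans hjk)⟩

theorem SameBlock.right {l : List ℕ} {i j k : ℕ} (h : SameBlock l i k) (hij : i ≤ j)
    (hjk : j ≤ k) : SameBlock l j k :=
  (h.left hij hjk).symm.trans h

theorem sameBlock_cons_iff {a : ℕ} {l : List ℕ} {i j : ℕ} :
    SameBlock (a :: l) i j ↔
      (i < a ∧ j < a) ∨ (a ≤ i ∧ a ≤ j ∧ SameBlock l (i - a) (j - a)) := by
  constructor
  · intro h
    have h1 : a ≤ i ↔ a ≤ j := by simpa using h 1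
    by_cases hi : a ≤ i
    · refine Or.inr ⟨hi, h1.1 hi, fun k => ?_⟩
      have := h (k + 1)
      have := h1.1 hi
      simp only [List.take_succ_cons, List.sum_cons] at *
      omega
    · have := mt h1.2 hi
      exact Or.inl (by omega)
  · rintro (h | ⟨h1, h2, h3⟩) k
    · rcases k with _ | k
      · simp
      · simp only [List.take_succ_cons, List.sum_cons]
        omega
    · rcases k with _ | k
      · simp
      · have := h3 k
        simp only [List.take_succ_cons, List.sum_cons]
        omega

/-- The pattern of a seaweed algebra given by lists of block sizes. -/
def listRel (lam mu : List ℕ) {n : ℕ} (i j : Fin n) : Prop :=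
  ((i : ℕ) < j → SameBlock lam i j) ∧ ((j : ℕ) < i → SameBlock mu i j)

theorem listRel_trans (lam mu : List ℕ) {n : ℕ} (i j k : Fin n) (hij : listRel lam mu i j)
    (hjk : listRel lam mu j k) : listRel lam mu i k := by
  obtain ⟨i, hi⟩ := i
  obtain ⟨j, hj⟩ := j
  obtain ⟨k, hk⟩ := k
  simp only [listRel] at *
  constructor
  · intro h
    rcases lt_trichotomy i j with h1 | rfl | h1
    · rcases lt_trichotomy j k with h2 | rfl | h2
      · exact (hij.1 h1).trans (hjk.1 h2)
      · exact hij.1 h1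
      · exact (hij.1 h1).left h.le h2.le
    · exact hjk.1 h
    · exact (hjk.1 (h1.trans h)).right h1.le h.le
  · intro h
    rcases lt_trichotomy i j with h1 | rfl | h1
    · exact ((hjk.2 (h.trans h1)).symm.left h.le h1.le).symm
    · exact hjk.2 h
    · rcases lt_trichotomy j k with h2 | rfl | h2
      · exact ((hij.2 h1).symm.right h2.le h.le).symm
      · exact hij.2 h1
      · exact (hij.2 h1).trans (hjk.2 h2)

/-- The index of the seaweed algebra on `n` points given by two lists of block sizes. -/
noncomputable def listIndex (K : Type*) [Field K] (n : ℕ) (lam mu : List ℕ) : ℕ :=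
  lieIndex K (patternAlgebra K (listRel (n := n) lam mu) (listRel_trans lam mu))

theorem composition_index_eq_iff {n : ℕ} (c : Composition n) (i j : Fin n) :
    c.index i = c.index j ↔ SameBlock c.blocks i j := by
  constructor
  · intro h k
    have key : ∀ i : Fin n, c.sizeUpTo k ≤ i ↔ k ≤ c.index i := by
      intro i
      constructor
      · intro hk
        by_contra hlt
        have h1 := c.lt_sizeUpTo_index_succ i
        have h2 : c.sizeUpTo (c.index i + 1) ≤ c.sizeUpTo k := c.monotone_sizeUpTo (by omega)
        simp only [Fin.val_succ] at h1
        omega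
      · intro hk
        exact (c.monotone_sizeUpTo hk).trans (c.sizeUpTo_index_le i)
    exact (key i).trans (h ▸ (key j).symm)
  · intro h
    have key : ∀ i j : Fin n, SameBlock c.blocks i j → ¬ c.index i < c.index j := by
      intro i j h hlt
      have h1 := c.lt_sizeUpTo_index_succ i
      have h2 : c.sizeUpTo (c.index i).succ ≤ c.sizeUpTo (c.index j) :=
        c.monotone_sizeUpTo (by simpa using hlt)
      have h3 := c.sizeUpTo_index_le j
      have h4 := (h (c.index i).succ).2 (h2.trans h3)
      exact absurd h4 (not_le.2 h1)
    exact le_antisymm (not_lt.1 (key j i h.symm)) (not_lt.1 (key i j h))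

variable {K : Type*} [Field K]

theorem meanderIndex_eq_listIndex {n : ℕ} (lam mu : Composition n) :
    meanderIndex K lam mu = listIndex K n lam.blocks mu.blocks := by
  have e : seaweedAlgebra K lam mu = patternAlgebra K (seaweedPattern lam mu)
    (fun _ _ _ => seaweedPattern_trans) := rfl
  rw [meanderIndex, e]
  refine lieIndex_patternAlgebra_embedding id Function.injective_id (fun i j => ?_)
    (fun x y _ => ⟨⟨x, rfl⟩, ⟨y, rfl⟩⟩)
  simp only [seaweedPattern, listRel, composition_index_eq_iff, id, Fin.lt_def]

theorem listIndex_congr {n : ℕ} {lam mu lam' mu' : List ℕ}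
    (h : ∀ i j, SameBlock lam i j ↔ SameBlock lam' i j)
    (h' : ∀ i j, SameBlock mu i j ↔ SameBlock mu' i j) :
    listIndex K n lam mu = listIndex K n lam' mu' :=
  lieIndex_patternAlgebra_embedding id Function.injective_id
    (fun i j => by simp only [listRel, h, h', id]) (fun x y _ => ⟨⟨x, rfl⟩, ⟨y, rfl⟩⟩)

/-- Folding with r = 0 creates empty blocks, which compositions do not allow but lists do. -/
theorem listIndex_zero_cons (n : ℕ) (lam mu : List ℕ) :
    listIndex K n (0 :: lam) mu = listIndex K n lam mu :=
  listIndex_congr (fun _ _ => by simp [sameBlock_cons_iff]) (fun _ _ => Iff.rfl)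

theorem listIndex_comm (n : ℕ) (lam mu : List ℕ) :
    listIndex K n lam mu = listIndex K n mu lam :=
  lieIndex_patternAlgebra_swap fun _ _ =>
    ⟨fun h => ⟨fun hij => (h.2 hij).symm, fun hij => (h.1 hij).symm⟩,
      fun h => ⟨fun hij => (h.2 hij).symm, fun hij => (h.1 hij).symm⟩⟩

theorem listIndex_zero (lam mu : List ℕ) : listIndex K 0 lam mu = 0 := by
  refine Nat.le_zero.1 ((lieIndex_le 0).trans ?_)
  have : Subsingleton (Matrix (Fin 0) (Fin 0) K) := inferInstance
  have : Subsingleton (patternAlgebra K (listRel (n := 0) lam mu) (listRel_trans lam mu)) :=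
    Subtype.val_injective.subsingleton
  exact (Module.finrank_zero_of_subsingleton).le

theorem listIndex_cons_cons [Infinite K] (a n : ℕ) (lam mu : List ℕ) :
    listIndex K (a + n) (a :: lam) (a :: mu) = a + listIndex K n lam mu := by
  have hrel : ∀ x y : Fin a ⊕ Fin n, listRel (a :: lam) (a :: mu) (finSumFinEquiv x)
      (finSumFinEquiv y) ↔ fullSumRel (listRel (n := n) lam mu) x y := by
    rintro (i | i) (j | j) <;>
    simp only [listRel, fullSumRel, sameBlock_cons_iff, finSumFinEquiv_apply_left,
      finSumFinEquiv_apply_right, Fin.val_castAdd, Fin.val_natAdd] 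
    · simp
    · have := i.2
      have := j.2
      simp only [iff_false]
      intro h
      have := h.1 (by omega)
      omega
    · have := i.2
      have := j.2
      simp only [iff_false]
      intro h
      have := h.2 (by omega)
      omega
    · simp
  have hS : ∀ x y z : Fin a ⊕ Fin n, fullSumRel (listRel (n := n) lam mu) x y →
      fullSumRel (listRel (n := n) lam mu) y z → fullSumRel (listRel (n := n) lam mu) x z := by
    intro x y z
    rw [← hrel, ← hrel, ← hrel]
    exact listRel_trans _ _ _ _ _
  rw [listIndex, lieIndex_patternAlgebra_embedding (hR := hS) finSumFinEquiv
    finSumFinEquiv.injective hrel (fun x y _ =>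
      ⟨finSumFinEquiv.surjective x, finSumFinEquiv.surjective y⟩), lieIndex_fullSumRel]
  rfl

/-- Transitivity of `unfoldRel` need not be checked separately: it is inherited from `listRel` along
e. -/
theorem listIndex_eq_of_unfold [Infinite K] {n n' : ℕ} {lam mu lam' mu' : List ℕ}
    {I M : Fin n' → Prop} (hU : Unfoldable (listRel lam' mu') I M) (e : Fin n → Fin n' ⊕ Fin n')
    (he : Function.Injective e)
    (h : ∀ i j, unfoldRel (listRel lam' mu') I M (e i) (e j) ↔ listRel lam mu i j)
    (hrange : ∀ x y, unfoldRel (listRel lam' mu') I M x y →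
      x ∈ Set.range e ∧ y ∈ Set.range e) :
    listIndex K n lam mu = listIndex K n' lam' mu' := by
  have htrans : ∀ x y z, unfoldRel (listRel lam' mu') I M x y →
      unfoldRel (listRel lam' mu') I M y z → unfoldRel (listRel lam' mu') I M x z := by
    intro x y z hxy hyz
    obtain ⟨⟨i, rfl⟩, ⟨j, rfl⟩⟩ := hrange _ _ hxy
    obtain ⟨-, ⟨k, rfl⟩⟩ := hrange _ _ hyz
    rw [h] at *
    exact listRel_trans _ _ _ _ _ hxy hyz
  have h1 := lieIndex_patternAlgebra_embedding (K := K) (hR' := htrans)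
    (hR := listRel_trans lam mu) e he h hrange
  rw [listIndex, listIndex, ← h1]
  exact lieIndex_unfoldRel hU

end Lists

/-! ### Panyushev's two reduction rules. -/

section FoldRules

variable {K : Type*} [Field K]

/-- I is the new block of size d and M the initial interval of length r + d, so I ⊆ M. The first d
points form the left copy, placed over I; the other points are shifted by d and form the right copy.
The extra clause of `unfoldRel` rejoins the blocks r and d below the diagonal. -/
theorem listIndex_fold_short [Infinite K] (d r n : ℕ) (hn : r + d ≤ n) (lam mu : List ℕ) :
    listIndex K (d + n) (d :: lam) ((2 * d + r) :: mu) = listIndex K n lam (r :: d :: mu) := by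
  let e : Fin (d + n) → Fin n ⊕ Fin n := fun x =>
    if h : (x : ℕ) < d then .inl ⟨r + x, by omega⟩ else .inr ⟨x - d, by omega⟩
  have e1 : ∀ x : Fin (d + n), ∀ h : (x : ℕ) < d, e x = .inl ⟨r + x, by omega⟩ :=
    fun x h => dif_pos h
  have e2 : ∀ x : Fin (d + n), ∀ h : ¬ (x : ℕ) < d, e x = .inr ⟨x - d, by omega⟩ :=
    fun x h => dif_neg h
  refine listIndex_eq_of_unfold (I := fun k => r ≤ (k : ℕ) ∧ (k : ℕ) < r + d)
    (M := fun k => (k : ℕ) < r + d) ⟨Or.inl fun i hi => hi.2, ?_, ?_, ?_, ?_⟩ e ?_ ?_ ?_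
  · rintro ⟨k, hk⟩ ⟨l, hl⟩ hkl hl'
    simp only [listRel, sameBlock_cons_iff] at *
    by_contra hc
    have := hkl.2 (by omega)
    omega
  · rintro ⟨k, hk⟩ ⟨l, hl⟩ hkl hk' hl'
    simp only [listRel, sameBlock_cons_iff] at *
    by_contra hc
    have := hkl.2 (by omega)
    omega
  · rintro ⟨k, hk⟩ ⟨l, hl⟩ hkl hk' hl'
    simp only at *
    omega
  · rintro ⟨k, hk⟩ ⟨l, hl⟩ hkl hk' hl'
    simp only at *
    omega
  · intro x y hxy
    by_cases hx : (x : ℕ) < d <;> by_cases hy : (y : ℕ) < d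
    · rw [e1 x hx, e1 y hy] at hxy
      simp only [Sum.inl.injEq, Fin.mk.injEq] at hxy
      exact Fin.ext (by omega)
    · rw [e1 x hx, e2 y hy] at hxy
      simp at hxy
    · rw [e2 x hx, e1 y hy] at hxy
      simp at hxy
    · rw [e2 x hx, e2 y hy] at hxy
      simp only [Sum.inr.injEq, Fin.mk.injEq] at hxy
      exact Fin.ext (by omega)
  · intro x y
    have hx2 := x.2
    have hy2 := y.2
    by_cases hx : (x : ℕ) < d <;> by_cases hy : (y : ℕ) < d
    · rw [e1 x hx, e1 y hy]
      simp only [unfoldRel, listRel, sameBlock_cons_iff]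
      omega
    · rw [e1 x hx, e2 y hy]
      simp only [unfoldRel, listRel, sameBlock_cons_iff, false_iff]
      intro h
      have := h.1 (by omega)
      omega
    · rw [e2 x hx, e1 y hy]
      simp only [unfoldRel, listRel, sameBlock_cons_iff]
      constructor
      · intro h
        exact ⟨fun h' => by omega, fun h' => Or.inl (by omega)⟩
      · intro h
        have := h.2 (by omega)
        omega
    · rw [e2 x hx, e2 y hy]
      simp only [unfoldRel, listRel, sameBlock_cons_iff]
      -- Both sides peel the same tail by different subtractions; aligning them makes the tail
      -- conditions identical.
      have s1 : (x : ℕ) - (2 * d + r) = x - d - r - d := by omega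
      have s2 : (y : ℕ) - (2 * d + r) = y - d - r - d := by omega
      rw [s1, s2]
      by_cases hS : SameBlock lam (x - d) (y - d) <;>
      by_cases hS' : SameBlock mu (x - d - r - d) (y - d - r - d) <;>
      simp only [hS, hS', implies_true, imp_false, and_true, true_and, and_false, or_false] <;>
      omega
  · have r1 : ∀ k : Fin n, r ≤ (k : ℕ) → (k : ℕ) < r + d → (Sum.inl k) ∈ Set.range e := by
      intro k h1 h2
      refine ⟨⟨k - r, by omega⟩, ?_⟩
      rw [e1 _ (by simp only; omega)]
      congr 1
      exact Fin.ext (by simp only; omega)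
    have r2 : ∀ k : Fin n, (Sum.inr k) ∈ Set.range e := by
      intro k
      refine ⟨⟨d + k, by omega⟩, ?_⟩
      rw [e2 _ (by simp only; omega)]
      congr 1
      exact Fin.ext (by simp only; omega)
    rintro (x | x) (y | y) hxy
    · exact ⟨r1 x hxy.1.1 hxy.1.2, r1 y hxy.2.1 hxy.2.2⟩
    · exact hxy.elim
    · exact ⟨r2 x, r1 y hxy.2.1 hxy.2.2⟩
    · exact ⟨r2 x, r2 y⟩

/-- Now I is the initial block of size d + r and M its last d points, so M ⊆ I and the extra clause
of `unfoldRel` is empty. The right copy omits the first r points. -/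
theorem listIndex_fold_long [Infinite K] (d r n : ℕ) (hn : r + d ≤ n) (lam mu : List ℕ) :
    listIndex K (d + n) ((d + r) :: lam) ((2 * d + r) :: mu) =
      listIndex K n (r :: lam) ((d + r) :: mu) := by
  let e : Fin (d + n) → Fin n ⊕ Fin n := fun x =>
    if h : (x : ℕ) < d + r then .inl ⟨x, by omega⟩ else .inr ⟨x - d, by omega⟩
  have e1 : ∀ x : Fin (d + n), ∀ h : (x : ℕ) < d + r, e x = .inl ⟨x, by omega⟩ :=
    fun x h => dif_pos h
  have e2 : ∀ x : Fin (d + n), ∀ h : ¬ (x : ℕ) < d + r, e x = .inr ⟨x - d, by omega⟩ :=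
    fun x h => dif_neg h
  refine listIndex_eq_of_unfold (I := fun k => (k : ℕ) < d + r)
    (M := fun k => r ≤ (k : ℕ) ∧ (k : ℕ) < d + r)
    ⟨Or.inr fun i hi => hi.2, ?_, ?_, ?_, ?_⟩ e ?_ ?_ ?_
  · rintro ⟨k, hk⟩ ⟨l, hl⟩ hkl hl'
    simp only [listRel, sameBlock_cons_iff] at *
    by_contra hc
    have := hkl.2 (by omega)
    omega
  · rintro ⟨k, hk⟩ ⟨l, hl⟩ hkl hk' hl'
    simp only at *
    omega
  · rintro ⟨k, hk⟩ ⟨l, hl⟩ hkl hk' hl'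
    simp only [listRel, sameBlock_cons_iff] at *
    by_contra hc
    have := hkl.1 (by omega)
    omega
  · rintro ⟨k, hk⟩ ⟨l, hl⟩ hk' hl' hl
    simp only [listRel, sameBlock_cons_iff] at *
    constructor <;> intro h <;> left <;> omega
  · intro x y hxy
    by_cases hx : (x : ℕ) < d + r <;> by_cases hy : (y : ℕ) < d + r
    · rw [e1 x hx, e1 y hy] at hxy
      simp only [Sum.inl.injEq, Fin.mk.injEq] at hxy
      exact Fin.ext (by omega)
    · rw [e1 x hx, e2 y hy] at hxy
      simp at hxy
    · rw [e2 x hx, e1 y hy] at hxy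
      simp at hxy
    · rw [e2 x hx, e2 y hy] at hxy
      simp only [Sum.inr.injEq, Fin.mk.injEq] at hxy
      exact Fin.ext (by omega)
  · intro x y
    have hx2 := x.2
    have hy2 := y.2
    by_cases hx : (x : ℕ) < d + r <;> by_cases hy : (y : ℕ) < d + r
    · rw [e1 x hx, e1 y hy]
      simp only [unfoldRel, listRel, sameBlock_cons_iff]
      omega
    · rw [e1 x hx, e2 y hy]
      simp only [unfoldRel, listRel, sameBlock_cons_iff, false_iff]
      intro h
      have := h.1 (by omega)
      omega
    · rw [e2 x hx, e1 y hy]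
      simp only [unfoldRel, listRel, sameBlock_cons_iff]
      constructor
      · intro h
        exact ⟨fun h' => by omega, fun h' => Or.inl (by omega)⟩
      · intro h
        have := h.2 (by omega)
        omega
    · rw [e2 x hx, e2 y hy]
      simp only [unfoldRel, listRel, sameBlock_cons_iff]
      have s1 : (x : ℕ) - (2 * d + r) = x - d - (d + r) := by omega
      have s2 : (y : ℕ) - (2 * d + r) = y - d - (d + r) := by omega
      have s3 : (x : ℕ) - (d + r) = x - d - r := by omega
      have s4 : (y : ℕ) - (d + r) = y - d - r := by omega
      rw [s1, s2, s3, s4]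
      by_cases hS : SameBlock lam (x - d - r) (y - d - r) <;>
      by_cases hS' : SameBlock mu (x - d - (d + r)) (y - d - (d + r)) <;>
      simp only [hS, hS', and_true, and_false, or_false] <;>
      omega
  · have r1 : ∀ k : Fin n, (k : ℕ) < d + r → (Sum.inl k) ∈ Set.range e := by
      intro k h
      refine ⟨⟨k, by omega⟩, ?_⟩
      rw [e1 _ (by simp only; omega)]
    have r2 : ∀ k : Fin n, r ≤ (k : ℕ) → (Sum.inr k) ∈ Set.range e := by
      intro k h
      refine ⟨⟨d + k, by omega⟩, ?_⟩
      rw [e2 _ (by simp only; omega)]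
      congr 1
      exact Fin.ext (by simp only; omega)
    rintro (x | x) (y | y) hxy
    · exact ⟨r1 x hxy.1, r1 y hxy.2⟩
    · exact hxy.elim
    · exact ⟨r2 x hxy.1.1, r1 y hxy.2⟩
    · exact ⟨r2 x (by have := hxy.1; omega), r2 y (by have := hxy.2.1; omega)⟩

end FoldRules

/-! ### Homogeneity of the index in the parts. -/

section Scaling

variable {K : Type*} [Field K]

/-- Every reduction rule is homogeneous in the parts. Removing an empty block shortens a list; the
other rules lower n without lengthening the lists in total, so the sum of n and both lengths
decreases. -/
theorem listIndex_map_mul [Infinite K] (c : ℕ) (lam mu : List ℕ) (n : ℕ) (h1 : lam.sum = n)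
    (h2 : mu.sum = n) :
    listIndex K (c * n) (lam.map (c * ·)) (mu.map (c * ·)) = c * listIndex K n lam mu := by
  induction hN : n + lam.length + mu.length using Nat.strong_induction_on
    generalizing lam mu n with
  | _ N ih =>
  have key : ∀ (a b : ℕ) (l m : List ℕ), (a :: l).sum = n → (b :: m).sum = n →
      n + (a :: l).length + (b :: m).length = N → a ≤ b →
      listIndex K (c * n) ((a :: l).map (c * ·)) ((b :: m).map (c * ·)) =
        c * listIndex K n (a :: l) (b :: m) := by
    intro a b l m h1 h2 hN hab
    simp only [List.sum_cons, List.length_cons] at h1 h2 hN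
    simp only [List.map_cons]
    rcases Nat.eq_zero_or_pos a with rfl | ha
    · rw [mul_zero, listIndex_zero_cons, listIndex_zero_cons, ← List.map_cons]
      exact ih _ (by simp only [List.length_cons]; omega) l (b :: m) n (by omega)
        (by simpa using h2) rfl
    rcases hab.eq_or_lt with rfl | hlt
    · obtain ⟨n', rfl⟩ : ∃ n', n = a + n' := ⟨n - a, by omega⟩
      rw [mul_add, listIndex_cons_cons, listIndex_cons_cons, mul_add,
        ih _ (by omega) l m n' (by omega) (by omega) rfl]
    · rcases le_or_gt a (b - a) with hle | hgt
      · obtain ⟨r, rfl⟩ : ∃ r, b = 2 * a + r := ⟨b - 2 * a, by omega⟩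
        obtain ⟨n', rfl⟩ : ∃ n', n = a + n' := ⟨n - a, by omega⟩
        have e : c * (2 * a + r) = 2 * (c * a) + c * r := by ring
        rw [e, mul_add, listIndex_fold_short _ _ _ (by
          rw [← mul_add]; exact Nat.mul_le_mul_left c (by omega)),
          listIndex_fold_short _ _ _ (by omega)]
        have := ih _ (by simp only [List.length_cons]; omega) l (r :: a :: m) n' (by omega)
          (by simp only [List.sum_cons]; omega) rfl
        simpa using this
      · obtain ⟨d, rfl⟩ : ∃ d, b = a + d := ⟨b - a, by omega⟩
        obtain ⟨r, rfl⟩ : ∃ r, a = d + r := ⟨a - d, by omega⟩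
        obtain ⟨n', rfl⟩ : ∃ n', n = d + n' := ⟨n - d, by omega⟩
        have e : c * (d + r + d) = 2 * (c * d) + c * r := by ring
        have e' : d + r + d = 2 * d + r := by ring
        rw [e, e', mul_add, mul_add, listIndex_fold_long _ _ _ (by
          rw [← mul_add]; exact Nat.mul_le_mul_left c (by omega)),
          listIndex_fold_long _ _ _ (by omega)]
        have := ih _ (by simp only [List.length_cons]; omega) (r :: l) ((d + r) :: m) n'
          (by simp only [List.sum_cons]; omega) (by simp only [List.sum_cons]; omega) rfl
        simpa [mul_add] using this
  rcases lam with _ | ⟨a, l⟩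
  · simp only [List.sum_nil] at h1
    subst h1
    rw [mul_zero, listIndex_zero, listIndex_zero, mul_zero]
  rcases mu with _ | ⟨b, m⟩
  · simp only [List.sum_nil] at h2
    subst h2
    rw [mul_zero, listIndex_zero, listIndex_zero, mul_zero]
  rcases le_total a b with hab | hab
  · exact key a b l m h1 h2 hN hab
  · rw [listIndex_comm, listIndex_comm n]
    exact key b a m l h2 h1 (by omega) hab

end Scaling

/-! ### Reductions for leading parts 1, 3 and 5. -/

section Letters

variable (K : Type*) [Field K] [Infinite K] (n : ℕ) (l m : List ℕ)

theorem listIndex_five_one :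
    listIndex K (5 + n) (5 :: l) (1 :: m) = listIndex K (4 + n) m (3 :: 1 :: l) := by
  rw [listIndex_comm, show 5 + n = 1 + (4 + n) by ring]
  exact listIndex_fold_short 1 3 (4 + n) (by omega) m l

theorem listIndex_one_five :
    listIndex K (5 + n) (1 :: l) (5 :: m) = listIndex K (4 + n) l (3 :: 1 :: m) := by
  rw [listIndex_comm, listIndex_five_one]

theorem listIndex_one_three :
    listIndex K (3 + n) (1 :: l) (3 :: m) = listIndex K (2 + n) l (1 :: 1 :: m) := by
  rw [show 3 + n = 1 + (2 + n) by ring]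
  exact listIndex_fold_short 1 1 (2 + n) (by omega) l m

theorem listIndex_five_three :
    listIndex K (5 + n) (5 :: l) (3 :: m) = listIndex K (3 + n) (1 :: m) (3 :: l) := by
  rw [listIndex_comm, show 5 + n = 2 + (3 + n) by ring]
  exact listIndex_fold_long 2 1 (3 + n) (by omega) m l

/-- Two folds lead from 5,l / 3,1,m through 1,1,m / 3,l to 1,m / 1,1,l, where a common 1 splits off.
-/
theorem listIndex_five_three_one :
    listIndex K (5 + n) (5 :: l) (3 :: 1 :: m) = 1 + listIndex K (1 + n) m (1 :: l) := by
  rw [listIndex_five_three, listIndex_one_three, show 2 + n = 1 + (1 + n) by ring,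
    listIndex_cons_cons]

theorem listIndex_five_one_one :
    listIndex K (5 + n) (5 :: l) (1 :: 1 :: m) = listIndex K (3 + n) m (1 :: 1 :: 1 :: l) := by
  rw [listIndex_five_one, show 4 + n = 3 + (1 + n) by ring, listIndex_one_three]
  congr 1
  ring

theorem listIndex_five_one_one_one :
    listIndex K (5 + n) (5 :: l) (1 :: 1 :: 1 :: m) =
      1 + listIndex K (2 + n) m (1 :: 1 :: l) := by
  rw [listIndex_five_one_one, show 3 + n = 1 + (2 + n) by ring, listIndex_cons_cons]

end Letters

/-! ### Generating functions, scaling and the linear system. -/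

section GenFun

open MvPowerSeries

/-- The generating function of a weighted set. -/
noncomputable def weightGenFun {α : Type*} (T : Set α) (wt : α → Fin 2 →₀ ℕ) :
    MvPowerSeries (Fin 2) ℚ :=
  fun d => ({a | a ∈ T ∧ wt a = d}.ncard : ℚ)

theorem coeff_weightGenFun {α : Type*} (T : Set α) (wt : α → Fin 2 →₀ ℕ) (d : Fin 2 →₀ ℕ) :
    coeff d (weightGenFun T wt) = ({a | a ∈ T ∧ wt a = d}.ncard : ℚ) := rfl

/-- Finiteness of the fibres matters because `Set.ncard` is 0 on infinite sets. -/
theorem weightGenFun_union {α : Type*} {T U : Set α} {wt : α → Fin 2 →₀ ℕ} (h : Disjoint T U)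
    (hfin : ∀ d, {a | a ∈ T ∪ U ∧ wt a = d}.Finite) :
    weightGenFun (T ∪ U) wt = weightGenFun T wt + weightGenFun U wt := by
  ext d
  rw [map_add, coeff_weightGenFun, coeff_weightGenFun, coeff_weightGenFun, ← Nat.cast_add,
    ← Set.ncard_union_eq _ ((hfin d).subset fun a ha => ⟨Or.inl ha.1, ha.2⟩)
      ((hfin d).subset fun a ha => ⟨Or.inr ha.1, ha.2⟩)]
  · congr 2
    ext a
    simp only [Set.mem_ofPred_eq, Set.mem_union]
    tauto
  · rw [Set.disjoint_left] at *
    exact fun a ha ha' => h ha.1 ha'.1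

theorem weightGenFun_image {α β : Type*} {T : Set α} {wt : α → Fin 2 →₀ ℕ}
    {wt' : β → Fin 2 →₀ ℕ} {f : α → β} (hf : Function.Injective f) (s : Fin 2 →₀ ℕ)
    (h : ∀ a ∈ T, wt' (f a) = s + wt a) :
    weightGenFun (f '' T) wt' = monomial s 1 * weightGenFun T wt := by
  classical
  ext d
  rw [coeff_monomial_mul, coeff_weightGenFun]
  split_ifs with hs
  · rw [one_mul, coeff_weightGenFun, ← Set.ncard_image_of_injective _ hf]
    congr 2
    ext b
    simp only [Set.mem_ofPred_eq, Set.mem_image]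
    constructor
    · rintro ⟨⟨a, ha, rfl⟩, hd⟩
      refine ⟨a, ⟨ha, ?_⟩, rfl⟩
      rw [← hd, h a ha, add_tsub_cancel_left]
    · rintro ⟨a, ⟨ha, hd⟩, rfl⟩
      refine ⟨⟨a, ha, rfl⟩, ?_⟩
      rw [h a ha, hd, add_tsub_cancel_of_le hs]
  · rw [Nat.cast_eq_zero]
    convert Set.ncard_empty β
    rw [Set.eq_empty_iff_forall_notMem]
    rintro _ ⟨⟨a, ha, rfl⟩, hd⟩
    exact hs (by rw [← hd, h a ha]; exact le_self_add)

theorem finite_setOf_list_sum (n : ℕ) :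
    {l : List ℕ | (∀ a ∈ l, 0 < a) ∧ l.sum = n}.Finite := by
  refine (Set.finite_range fun c : Composition n => c.blocks).subset ?_
  rintro l ⟨h1, h2⟩
  exact ⟨⟨l, fun {a} ha => h1 a ha, h2⟩, rfl⟩

theorem meanderCount_eq_ncard (K : Type*) [Field K] {J : Set ℕ} (hJ : ∀ a ∈ J, 0 < a) (n k : ℕ) :
    meanderCount K J n k = {p : List ℕ × List ℕ | (∀ a ∈ p.1, a ∈ J) ∧ (∀ a ∈ p.2, a ∈ J) ∧
      p.1.sum = n ∧ p.2.sum = n ∧ listIndex K n p.1 p.2 = k}.ncard := by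
  have hinj : Function.Injective
      (fun p : Composition n × Composition n => (p.1.blocks, p.2.blocks)) := by
    rintro ⟨a, b⟩ ⟨c, d⟩ h
    simp only [Prod.mk.injEq] at h
    exact Prod.ext (Composition.ext h.1) (Composition.ext h.2)
  rw [meanderCount, ← Set.ncard_image_of_injective _ hinj]
  congr 1
  ext ⟨l, m⟩
  simp only [Set.mem_image, Set.mem_ofPred_eq, Prod.mk.injEq]
  constructor
  · rintro ⟨p, ⟨h1, h2, h3⟩, rfl, rfl⟩
    exact ⟨h1, h2, p.1.blocks_sum, p.2.blocks_sum, by rw [← h3, meanderIndex_eq_listIndex]⟩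
  · rintro ⟨h1, h2, h3, h4, h5⟩
    refine ⟨(⟨l, fun {a} ha => hJ a (h1 a ha), h3⟩, ⟨m, fun {a} ha => hJ a (h2 a ha), h4⟩),
      ⟨h1, h2, ?_⟩, rfl, rfl⟩
    rw [meanderIndex_eq_listIndex]
    exact h5

theorem meanderGenFun_scale (K : Type*) [Field K] [Infinite K] (c : ℕ) (hc : c ≠ 0) :
    meanderGenFun K {c, 5 * c} = expand c hc (meanderGenFun K {1, 5}) := by
  have hc' : 0 < c := Nat.pos_of_ne_zero hc
  have hJ : ∀ a ∈ ({c, 5 * c} : Set ℕ), 0 < a := by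
    rintro a (rfl | rfl) <;> omega
  have hJ1 : ∀ a ∈ ({1, 5} : Set ℕ), 0 < a := by
    rintro a (rfl | rfl) <;> omega
  have hlist : ∀ l : List ℕ, (∀ a ∈ l, a ∈ ({c, 5 * c} : Set ℕ)) →
      ∃ l' : List ℕ, (∀ a ∈ l', a ∈ ({1, 5} : Set ℕ)) ∧ l'.map (c * ·) = l := by
    intro l
    induction l with
    | nil => exact fun _ => ⟨[], by simp, rfl⟩
    | cons a l ih =>
      intro h
      obtain ⟨l', h1, h2⟩ := ih fun b hb => h b (List.mem_cons_of_mem a hb)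
      rcases h a List.mem_cons_self with ha | ha
      · refine ⟨1 :: l', ?_, by simp [h2, ha]⟩
        rintro b hb
        rcases List.mem_cons.1 hb with rfl | hb
        · exact Or.inl rfl
        · exact h1 b hb
      · rw [Set.mem_singleton_iff] at ha
        refine ⟨5 :: l', ?_, by simp [h2, ha, mul_comm]⟩
        rintro b hb
        rcases List.mem_cons.1 hb with rfl | hb
        · exact Or.inr rfl
        · exact h1 b hb
  have hmap : ∀ l : List ℕ, (∀ a ∈ l, a ∈ ({1, 5} : Set ℕ)) →
      ∀ a ∈ l.map (c * ·), a ∈ ({c, 5 * c} : Set ℕ) := by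
    intro l hl a ha
    obtain ⟨b, hb, rfl⟩ := List.mem_map.1 ha
    rcases hl b hb with rfl | h5
    · exact Or.inl (mul_one c)
    · rw [Set.mem_singleton_iff] at h5
      subst h5
      exact Or.inr (mul_comm c 5)
  have hsum : ∀ l : List ℕ, (l.map (c * ·)).sum = c * l.sum := fun l => by
    simpa using List.sum_map_mul_left (l := l) (f := id) (r := c)
  have hinj : Function.Injective (fun p : List ℕ × List ℕ =>
      (p.1.map (c * ·), p.2.map (c * ·))) := by
    have h0 : Function.Injective (fun a : ℕ => c * a) := fun a b h =>
      Nat.eq_of_mul_eq_mul_left hc' h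
    exact h0.list_map.prodMap h0.list_map
  have hset : ∀ n k : ℕ, {p : List ℕ × List ℕ | (∀ a ∈ p.1, a ∈ ({c, 5 * c} : Set ℕ)) ∧
      (∀ a ∈ p.2, a ∈ ({c, 5 * c} : Set ℕ)) ∧ p.1.sum = n ∧ p.2.sum = n ∧
      listIndex K n p.1 p.2 = k} = (fun p : List ℕ × List ℕ =>
        (p.1.map (c * ·), p.2.map (c * ·))) '' {p : List ℕ × List ℕ |
      (∀ a ∈ p.1, a ∈ ({1, 5} : Set ℕ)) ∧ (∀ a ∈ p.2, a ∈ ({1, 5} : Set ℕ)) ∧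
      c * p.1.sum = n ∧ p.2.sum = p.1.sum ∧ c * listIndex K p.1.sum p.1 p.2 = k} := by
    intro n k
    ext ⟨l, m⟩
    simp only [Set.mem_image, Set.mem_ofPred_eq, Prod.mk.injEq, Prod.exists]
    constructor
    · rintro ⟨h1, h2, h3, h4, h5⟩
      obtain ⟨l, hl, rfl⟩ := hlist l h1
      obtain ⟨m, hm, rfl⟩ := hlist m h2
      rw [hsum] at h3 h4
      have h6 : m.sum = l.sum := Nat.eq_of_mul_eq_mul_left hc' (h4.trans h3.symm)
      refine ⟨l, m, ⟨hl, hm, h3, h6, ?_⟩, rfl, rfl⟩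
      rw [← listIndex_map_mul c l m _ rfl h6, h3, h5]
    · rintro ⟨l, m, ⟨h1, h2, h3, h4, h5⟩, rfl, rfl⟩
      refine ⟨hmap l h1, hmap m h2, by rw [hsum, h3], by rw [hsum, h4, h3], ?_⟩
      rw [← h3, listIndex_map_mul c l m _ rfl h4, h5]
  ext d
  have hcoeff : ∀ (J : Set ℕ) (d : Fin 2 →₀ ℕ), coeff d (meanderGenFun K J) =
    (meanderCount K J (d 0) (d 1) : ℚ) := fun _ _ => rfl
  rw [hcoeff, meanderCount_eq_ncard K hJ, hset, Set.ncard_image_of_injective _ hinj]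
  by_cases hd : ∀ i, c ∣ d i
  · obtain ⟨d', rfl⟩ : ∃ d' : Fin 2 →₀ ℕ, d = c • d' := by
      refine ⟨d.mapRange (· / c) (Nat.zero_div c), ?_⟩
      ext i
      simp [Nat.mul_div_cancel' (hd i)]
    rw [coeff_expand_smul, hcoeff, meanderCount_eq_ncard K hJ1]
    congr 2
    ext ⟨l, m⟩
    simp only [Set.mem_ofPred_eq, Finsupp.smul_apply, smul_eq_mul]
    refine and_congr_right fun _ => and_congr_right fun _ => ?_
    constructor
    · rintro ⟨h3, h4, h5⟩
      have h3' := Nat.eq_of_mul_eq_mul_left hc' h3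
      exact ⟨h3', h4.trans h3', by rw [← h3']; exact Nat.eq_of_mul_eq_mul_left hc' h5⟩
    · rintro ⟨h3, h4, h5⟩
      exact ⟨by rw [h3], h4.trans h3.symm, by rw [h3, h5]⟩
  -- Both the number of points and the index of a scaled pair are multiples of c, so these
  -- coefficients vanish on both sides.
  · push Not at hd
    obtain ⟨i, hi⟩ := hd
    rw [coeff_expand_of_not_dvd c hc _ hi, Nat.cast_eq_zero]
    convert Set.ncard_empty (List ℕ × List ℕ)
    rw [Set.eq_empty_iff_forall_notMem]
    rintro ⟨l, m⟩ ⟨-, -, h3, -, h5⟩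
    apply hi
    fin_cases i
    · exact ⟨_, h3.symm⟩
    · exact ⟨_, h5.symm⟩

/-- Pairs of lists over `{1, 5}` whose sums differ by the sum of `w`. -/
def prefixedPairs (w : List ℕ) : Set (List ℕ × List ℕ) :=
  {p | (∀ a ∈ p.1, a ∈ ({1, 5} : Set ℕ)) ∧ (∀ a ∈ p.2, a ∈ ({1, 5} : Set ℕ)) ∧
    p.1.sum = w.sum + p.2.sum}

/-- The weight of a pair: the number of points and the index of the seaweed algebra obtained by
prefixing the second list with `w`. -/
noncomputable def prefixedWeight (K : Type*) [Field K] (w : List ℕ) (p : List ℕ × List ℕ) :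
    Fin 2 →₀ ℕ :=
  Finsupp.single 0 p.1.sum + Finsupp.single 1 (listIndex K p.1.sum p.1 (w ++ p.2))

/-- The generating function of pairs of lists over `{1, 5}`, the second prefixed with `w`. -/
noncomputable def prefixedGenFun (K : Type*) [Field K] (w : List ℕ) : MvPowerSeries (Fin 2) ℚ :=
  weightGenFun (prefixedPairs w) (prefixedWeight K w)

theorem finite_prefixedPairs (K : Type*) [Field K] (w : List ℕ) (d : Fin 2 →₀ ℕ) :
    {p | p ∈ prefixedPairs w ∧ prefixedWeight K w p = d}.Finite := by
  have hJ1 : ∀ a ∈ ({1, 5} : Set ℕ), 0 < a := by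
    rintro a (rfl | rfl) <;> omega
  refine ((finite_setOf_list_sum (d 0)).prod (finite_setOf_list_sum (d 0 - w.sum))).subset ?_
  rintro ⟨l, m⟩ ⟨⟨h1, h2, h3⟩, h4⟩
  have h0 : l.sum = d 0 := by rw [← h4]; simp [prefixedWeight]
  simp only at h1 h2 h3
  exact ⟨⟨fun a ha => hJ1 a (h1 a ha), h0⟩, ⟨fun a ha => hJ1 a (h2 a ha), by simp only; omega⟩⟩

theorem meanderGenFun_eq_prefixedGenFun (K : Type*) [Field K] :
    meanderGenFun K {1, 5} = prefixedGenFun K [] := by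
  have hJ1 : ∀ a ∈ ({1, 5} : Set ℕ), 0 < a := by
    rintro a (rfl | rfl) <;> omega
  funext d
  rw [meanderGenFun, meanderCount_eq_ncard K hJ1]
  change _ = (({p | p ∈ prefixedPairs [] ∧ prefixedWeight K [] p = d}.ncard : ℕ) : ℚ)
  congr 2
  ext ⟨l, m⟩
  simp only [prefixedPairs, prefixedWeight, Set.mem_ofPred_eq, List.sum_nil, zero_add,
    List.nil_append, and_assoc]
  refine and_congr_right fun _ => and_congr_right fun _ => ?_
  constructor
  · rintro ⟨h1, h2, h3⟩
    refine ⟨h1.trans h2.symm, ?_⟩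
    ext i
    fin_cases i
    · simpa using h1
    · simpa [h1] using h3
  · rintro ⟨h1, rfl⟩
    simp [h1]

theorem monomial_single_add_single (a b : ℕ) :
    monomial (Finsupp.single 0 a + Finsupp.single 1 b) (1 : ℚ) =
      (X 0 : MvPowerSeries (Fin 2) ℚ) ^ a * X 1 ^ b := by
  rw [X_pow_eq, X_pow_eq, monomial_mul_monomial, one_mul]

theorem single_add_single_eq {a a₁ a₂ b b₁ b₂ : ℕ} (ha : a = a₁ + a₂) (hb : b = b₁ + b₂) :
    (Finsupp.single 0 a + Finsupp.single 1 b : Fin 2 →₀ ℕ) =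
      (Finsupp.single 0 a₁ + Finsupp.single 1 b₁) +
        (Finsupp.single 0 a₂ + Finsupp.single 1 b₂) := by
  rw [ha, hb, Finsupp.single_add, Finsupp.single_add, add_add_add_comm]

theorem weightGenFun_singleton {α : Type*} (a : α) (wt : α → Fin 2 →₀ ℕ) :
    weightGenFun {a} wt = monomial (wt a) 1 := by
  classical
  ext d
  rw [coeff_monomial, coeff_weightGenFun]
  split_ifs with h
  · have : {b | b ∈ ({a} : Set α) ∧ wt b = d} = {a} := by
      ext b
      simp only [Set.mem_ofPred_eq, Set.mem_singleton_iff]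
      exact ⟨fun hb => hb.1, fun hb => ⟨hb, by rw [hb, h]⟩⟩
    rw [this, Set.ncard_singleton, Nat.cast_one]
  · have : {b | b ∈ ({a} : Set α) ∧ wt b = d} = ∅ := by
      ext b
      simp only [Set.mem_ofPred_eq, Set.mem_singleton_iff, Set.mem_empty_iff_false, iff_false]
      rintro ⟨rfl, hb⟩
      exact h hb.symm
    rw [this, Set.ncard_empty, Nat.cast_zero]

theorem mem_pair_of_cons {a : ℕ} {l : List ℕ} (h : ∀ b ∈ a :: l, b ∈ ({1, 5} : Set ℕ)) :
    (a = 1 ∨ a = 5) ∧ ∀ b ∈ l, b ∈ ({1, 5} : Set ℕ) :=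
  ⟨h a List.mem_cons_self, fun b hb => h b (List.mem_cons_of_mem a hb)⟩

theorem forall_mem_cons_pair {a : ℕ} {l : List ℕ} (ha : a = 1 ∨ a = 5)
    (h : ∀ b ∈ l, b ∈ ({1, 5} : Set ℕ)) : ∀ b ∈ a :: l, b ∈ ({1, 5} : Set ℕ) := by
  rintro b hb
  rcases List.mem_cons.1 hb with rfl | hb
  · exact ha
  · exact h b hb

/-- Case on the first letter of the unprefixed list, nonempty because w has positive sum. After a 5
the two sides exchange roles, hence the swapped pair; the number of points drops by 5 - w₅.sum =
w.sum, which explains the power of x. -/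
theorem prefixedGenFun_rec (K : Type*) [Field K] (w w₁ w₅ : List ℕ) (e₁ e₅ : ℕ)
    (hs₁ : w.sum = 1 + w₁.sum) (hs₅ : w.sum + w₅.sum = 5)
    (h₁ : ∀ l m k, listIndex K (1 + (w₁.sum + k)) (1 :: l) (w ++ m) =
      e₁ + listIndex K (w₁.sum + k) l (w₁ ++ m))
    (h₅ : ∀ l m k, listIndex K (5 + k) (5 :: l) (w ++ m) =
      e₅ + listIndex K (w₅.sum + k) m (w₅ ++ l)) :
    prefixedGenFun K w = X 0 * X 1 ^ e₁ * prefixedGenFun K w₁ +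
      X 0 ^ w.sum * X 1 ^ e₅ * prefixedGenFun K w₅ := by
  have hT : prefixedPairs w = (fun p : List ℕ × List ℕ => (1 :: p.1, p.2)) '' prefixedPairs w₁ ∪
      (fun p : List ℕ × List ℕ => (5 :: p.2, p.1)) '' prefixedPairs w₅ := by
    ext ⟨l, m⟩
    simp only [Set.mem_union, Set.mem_image, Prod.exists, Prod.mk.injEq]
    constructor
    · rintro ⟨h1, h2, h3⟩
      rcases l with _ | ⟨a, l⟩
      · simp only [List.sum_nil] at h3
        omega
      · obtain ⟨ha, hl⟩ := mem_pair_of_cons h1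
        simp only [List.sum_cons] at h3
        rcases ha with rfl | rfl
        · exact Or.inl ⟨l, m, ⟨hl, h2, by simp only; omega⟩, rfl, rfl⟩
        · exact Or.inr ⟨m, l, ⟨h2, hl, by simp only; omega⟩, rfl, rfl⟩
    · rintro (⟨l, m, ⟨h1, h2, h3⟩, rfl, rfl⟩ | ⟨m, l, ⟨h1, h2, h3⟩, rfl, rfl⟩)
      · refine ⟨forall_mem_cons_pair (Or.inl rfl) h1, h2, ?_⟩
        simp only [List.sum_cons] at h3 ⊢
        omega
      · refine ⟨forall_mem_cons_pair (Or.inr rfl) h2, h1, ?_⟩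
        simp only [List.sum_cons] at h3 ⊢
        omega
  have hfin := finite_prefixedPairs K w
  rw [hT] at hfin
  rw [prefixedGenFun, hT, weightGenFun_union _ hfin,
    weightGenFun_image (f := fun p : List ℕ × List ℕ => (1 :: p.1, p.2))
      (by rintro ⟨a, b⟩ ⟨c, d⟩ h; simpa using h) (Finsupp.single 0 1 + Finsupp.single 1 e₁),
    weightGenFun_image (f := fun p : List ℕ × List ℕ => (5 :: p.2, p.1))
      (by rintro ⟨a, b⟩ ⟨c, d⟩ h; simpa [and_comm] using h)
      (Finsupp.single 0 w.sum + Finsupp.single 1 e₅),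
    monomial_single_add_single, monomial_single_add_single, pow_one]
  · rfl
  · rintro ⟨m, l⟩ ⟨-, -, h3⟩
    simp only [prefixedWeight, List.sum_cons] at h3 ⊢
    rw [h₅, h3]
    exact single_add_single_eq (by omega) rfl
  · rintro ⟨l, m⟩ ⟨-, -, h3⟩
    simp only [prefixedWeight, List.sum_cons] at h3 ⊢
    rw [h3, h₁]
    exact single_add_single_eq rfl rfl
  · rw [Set.disjoint_left]
    rintro _ ⟨p, -, rfl⟩ ⟨q, -, hq⟩
    simp at hq

/-- The empty pair gives 1, equal first letters split off gl_1 or gl_5, and the cases 1/5 and 5/1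
fold to the prefix 3,1 by symmetry, hence the factor 2. -/
theorem prefixedGenFun_nil (K : Type*) [Field K] [Infinite K] :
    prefixedGenFun K [] = 1 + (X 0 * X 1 + X 0 ^ 5 * X 1 ^ 5) * prefixedGenFun K [] +
      2 * X 0 * prefixedGenFun K [3, 1] := by
  have hT : prefixedPairs [] = {([], [])} ∪
      ((fun p : List ℕ × List ℕ => (1 :: p.1, 1 :: p.2)) '' prefixedPairs [] ∪
      ((fun p : List ℕ × List ℕ => (5 :: p.1, 5 :: p.2)) '' prefixedPairs [] ∪
      ((fun p : List ℕ × List ℕ => (1 :: p.1, 5 :: p.2)) '' prefixedPairs [3, 1] ∪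
      (fun p : List ℕ × List ℕ => (5 :: p.2, 1 :: p.1)) '' prefixedPairs [3, 1]))) := by
    ext ⟨l, m⟩
    simp only [Set.mem_union, Set.mem_image, Prod.exists, Prod.mk.injEq, Set.mem_singleton_iff]
    constructor
    · rintro ⟨h1, h2, h3⟩
      rcases l with _ | ⟨a, l⟩ <;> rcases m with _ | ⟨b, m⟩
      · exact Or.inl ⟨rfl, rfl⟩
      · obtain ⟨hb, hm⟩ := mem_pair_of_cons h2
        simp only [List.sum_cons, List.sum_nil] at h3
        omega
      · obtain ⟨ha, hl⟩ := mem_pair_of_cons h1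
        simp only [List.sum_cons, List.sum_nil] at h3
        omega
      · obtain ⟨ha, hl⟩ := mem_pair_of_cons h1
        obtain ⟨hb, hm⟩ := mem_pair_of_cons h2
        simp only [List.sum_cons, List.sum_nil] at h3
        right
        rcases ha with rfl | rfl <;> rcases hb with rfl | rfl
        · exact Or.inl ⟨l, m, ⟨hl, hm, by simp; omega⟩, rfl, rfl⟩
        · exact Or.inr (Or.inr (Or.inl ⟨l, m, ⟨hl, hm, by simp; omega⟩, rfl, rfl⟩))
        · exact Or.inr (Or.inr (Or.inr ⟨m, l, ⟨hm, hl, by simp; omega⟩, rfl, rfl⟩))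
        · exact Or.inr (Or.inl ⟨l, m, ⟨hl, hm, by simp; omega⟩, rfl, rfl⟩)
    · rintro (⟨rfl, rfl⟩ | ⟨l, m, ⟨h1, h2, h3⟩, rfl, rfl⟩ |
        ⟨l, m, ⟨h1, h2, h3⟩, rfl, rfl⟩ | ⟨l, m, ⟨h1, h2, h3⟩, rfl, rfl⟩ |
        ⟨m, l, ⟨h1, h2, h3⟩, rfl, rfl⟩)
      · simp [prefixedPairs]
      all_goals simp only [List.sum_cons, List.sum_nil] at h3
      · exact ⟨forall_mem_cons_pair (Or.inl rfl) h1, forall_mem_cons_pair (Or.inl rfl) h2,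
          by simp; omega⟩
      · exact ⟨forall_mem_cons_pair (Or.inr rfl) h1, forall_mem_cons_pair (Or.inr rfl) h2,
          by simp; omega⟩
      · exact ⟨forall_mem_cons_pair (Or.inl rfl) h1, forall_mem_cons_pair (Or.inr rfl) h2,
          by simp; omega⟩
      · exact ⟨forall_mem_cons_pair (Or.inr rfl) h2, forall_mem_cons_pair (Or.inl rfl) h1,
          by simp; omega⟩
  have hfin : ∀ U ⊆ prefixedPairs [], ∀ d, {p | p ∈ U ∧ prefixedWeight K [] p = d}.Finite :=
    fun U hU d => (finite_prefixedPairs K [] d).subset fun p hp => ⟨hU hp.1, hp.2⟩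
  have hsub := hT.ge
  have hs1 := hsub
  have hs2 := Set.subset_union_right.trans hs1
  have hs3 := Set.subset_union_right.trans hs2
  have hs4 := Set.subset_union_right.trans hs3
  have e0 : weightGenFun {(([] : List ℕ), ([] : List ℕ))} (prefixedWeight K []) = 1 := by
    rw [weightGenFun_singleton]
    simp [prefixedWeight, listIndex_zero]
  have e1 : weightGenFun ((fun p : List ℕ × List ℕ => (1 :: p.1, 1 :: p.2)) '' prefixedPairs [])
      (prefixedWeight K []) = X 0 * X 1 * prefixedGenFun K [] := by
    rw [weightGenFun_image (by rintro ⟨a, b⟩ ⟨c, d⟩ h; simpa using h)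
      (Finsupp.single 0 1 + Finsupp.single 1 1), monomial_single_add_single, pow_one, pow_one]
    · rfl
    · rintro ⟨l, m⟩ ⟨-, -, h3⟩
      simp only [prefixedWeight, List.sum_cons, List.nil_append]
      rw [listIndex_cons_cons]
      exact single_add_single_eq rfl rfl
  have e2 : weightGenFun ((fun p : List ℕ × List ℕ => (5 :: p.1, 5 :: p.2)) '' prefixedPairs [])
      (prefixedWeight K []) = X 0 ^ 5 * X 1 ^ 5 * prefixedGenFun K [] := by
    rw [weightGenFun_image (by rintro ⟨a, b⟩ ⟨c, d⟩ h; simpa using h)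
      (Finsupp.single 0 5 + Finsupp.single 1 5), monomial_single_add_single]
    · rfl
    · rintro ⟨l, m⟩ ⟨-, -, h3⟩
      simp only [prefixedWeight, List.sum_cons, List.nil_append]
      rw [listIndex_cons_cons]
      exact single_add_single_eq rfl rfl
  have e3 : weightGenFun
      ((fun p : List ℕ × List ℕ => (1 :: p.1, 5 :: p.2)) '' prefixedPairs [3, 1])
      (prefixedWeight K []) = X 0 * prefixedGenFun K [3, 1] := by
    rw [weightGenFun_image (by rintro ⟨a, b⟩ ⟨c, d⟩ h; simpa using h)
      (Finsupp.single 0 1 + Finsupp.single 1 0), monomial_single_add_single, pow_one, pow_zero,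
      mul_one]
    · rfl
    · rintro ⟨l, m⟩ ⟨-, -, h3⟩
      simp only [List.sum_cons, List.sum_nil] at h3
      simp only [prefixedWeight, List.sum_cons, List.nil_append, List.cons_append]
      rw [show 1 + l.sum = 5 + m.sum by omega, listIndex_one_five,
        show l.sum = 4 + m.sum by omega]
      exact single_add_single_eq (by omega) (by omega)
  have e4 : weightGenFun
      ((fun p : List ℕ × List ℕ => (5 :: p.2, 1 :: p.1)) '' prefixedPairs [3, 1])
      (prefixedWeight K []) = X 0 * prefixedGenFun K [3, 1] := by
    rw [weightGenFun_image (by rintro ⟨a, b⟩ ⟨c, d⟩ h; simpa [and_comm] using h)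
      (Finsupp.single 0 1 + Finsupp.single 1 0), monomial_single_add_single, pow_one, pow_zero,
      mul_one]
    · rfl
    · rintro ⟨m, l⟩ ⟨-, -, h3⟩
      simp only [List.sum_cons, List.sum_nil] at h3
      simp only [prefixedWeight, List.sum_cons, List.nil_append, List.cons_append]
      rw [listIndex_five_one, show m.sum = 4 + l.sum by omega]
      exact single_add_single_eq (by omega) (by omega)
  nth_rw 1 [prefixedGenFun]
  rw [hT, weightGenFun_union _ (hfin _ hs1), weightGenFun_union _ (hfin _ hs2),
    weightGenFun_union _ (hfin _ hs3), weightGenFun_union _ (hfin _ hs4), e0, e1, e2, e3, e4]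
  · ring
  all_goals
    rw [Set.disjoint_left]
    rintro ⟨l, m⟩ h h'
    simp only [Set.mem_union, Set.mem_image, Prod.exists, Prod.mk.injEq,
      Set.mem_singleton_iff] at h h'
    grind

theorem prefixedGenFun_three_one (K : Type*) [Field K] [Infinite K] :
    prefixedGenFun K [3, 1] = X 0 * prefixedGenFun K [1, 1, 1] +
      X 0 ^ 4 * X 1 * prefixedGenFun K [1] := by
  have h := prefixedGenFun_rec K [3, 1] [1, 1, 1] [1] 0 1 rfl rfl
    (fun l m k => by
      have := listIndex_one_three K (1 + k) l (1 :: m)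
      simp only [List.sum_cons, List.sum_nil, List.cons_append, List.nil_append, zero_add]
      convert this using 2 <;> ring)
    (fun l m k => listIndex_five_three_one K k l m)
  simpa using h

theorem prefixedGenFun_one (K : Type*) [Field K] [Infinite K] :
    prefixedGenFun K [1] = X 0 * X 1 * prefixedGenFun K [] +
      X 0 * prefixedGenFun K [3, 1] := by
  have h := prefixedGenFun_rec K [1] [] [3, 1] 1 0 rfl rfl
    (fun l m k => listIndex_cons_cons 1 _ l m)
    (fun l m k => by rw [zero_add]; exact listIndex_five_one K k l m)
  simpa using h

theorem prefixedGenFun_one_one (K : Type*) [Field K] [Infinite K] :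
    prefixedGenFun K [1, 1] = X 0 * X 1 * prefixedGenFun K [1] +
      X 0 ^ 2 * prefixedGenFun K [1, 1, 1] := by
  have h := prefixedGenFun_rec K [1, 1] [1] [1, 1, 1] 1 0 rfl rfl
    (fun l m k => listIndex_cons_cons 1 _ l _)
    (fun l m k => by rw [zero_add]; exact listIndex_five_one_one K k l m)
  simpa using h

theorem prefixedGenFun_one_one_one (K : Type*) [Field K] [Infinite K] :
    prefixedGenFun K [1, 1, 1] = X 0 * X 1 * prefixedGenFun K [1, 1] +
      X 0 ^ 3 * X 1 * prefixedGenFun K [1, 1] := by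
  have h := prefixedGenFun_rec K [1, 1, 1] [1, 1] [1, 1] 1 1 rfl rfl
    (fun l m k => listIndex_cons_cons 1 _ l _)
    (fun l m k => listIndex_five_one_one_one K k l m)
  simpa using h

end GenFun

theorem mainTheorem6 (K : Type*) [Field K] [CharZero K]
    (x y f g : MvPowerSeries (Fin 2) ℚ)
    (hx : x = MvPowerSeries.X 0) (hy : y = MvPowerSeries.X 1)
    (hf : f = 1 - x ^ 3 * y - x ^ 4 * y ^ 2 - 2 * x ^ 5 * y - x ^ 6 * y ^ 2 + x ^ 8 * y ^ 2
      + x ^ 10 * y ^ 2)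
    (hg : g = (1 - x * y - x ^ 5 * y ^ 5) * f
      - 2 * x ^ 5 * y ^ 2 * (x + y + x ^ 2 * y - x ^ 4 * y - x ^ 6 * y)) :
    (IsUnit g ∧ meanderGenFun K {1, 5} = f * g⁻¹) ∧
    (∀ (c : ℕ) (hc : 1 ≤ c),
      meanderGenFun K {c, 5 * c} =
        MvPowerSeries.expand c (Nat.one_le_iff_ne_zero.mp hc) (meanderGenFun K {1, 5})) := by
  have hinf : Infinite K := CharZero.infinite K
  refine ⟨?_, fun c hc => meanderGenFun_scale K c _⟩
  have hg0 : MvPowerSeries.constantCoeff g = 1 := by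
    rw [hg, hf, hx, hy]
    simp
  refine ⟨MvPowerSeries.isUnit_iff_constantCoeff.2 (by rw [hg0]; exact isUnit_one), ?_⟩
  rw [MvPowerSeries.eq_mul_inv_iff_mul_eq (by rw [hg0]; exact one_ne_zero),
    meanderGenFun_eq_prefixedGenFun]
  have e0 := prefixedGenFun_nil K
  have e1 := prefixedGenFun_three_one K
  have e2 := prefixedGenFun_one K
  have e3 := prefixedGenFun_one_one_one K
  have e4 := prefixedGenFun_one_one K
  rw [← hx, ← hy] at e0 e1 e2 e3 e4
  rw [hg, hf]
  -- With D = 1 - x³y - x⁵y, the equations for F_111 and F_11 give D F_111 = (xy + x³y)xy F_1, so D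
  -- F_31 = p F_1, where p is the multiplier of `e2`. Substituting F_1 gives (D - xp)F_31 = xyp F_∅
  -- with D - xp = f; the first equation times f then becomes g F_∅ = f.
  linear_combination (1 - x ^ 3 * y - x ^ 4 * y ^ 2 - 2 * x ^ 5 * y - x ^ 6 * y ^ 2 + x ^ 8 * y ^ 2
    + x ^ 10 * y ^ 2) * e0 + 2 * x * ((1 - x ^ 3 * y - x ^ 5 * y) * e1 +
      x * (e3 + (x * y + x ^ 3 * y) * e4) +
      (x ^ 3 * y ^ 2 + x ^ 5 * y ^ 2 + x ^ 4 * y - x ^ 7 * y ^ 2 - x ^ 9 * y ^ 2) * e2)
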